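/- Let $n\ge 1$, $N=2n+1$, $T=\mathbb R^{N}$ with standard orthonormal basis $\theta_1,\dots,\theta_{N}$ and dual basis $\theta^1,\dots,\theta^N$, and let $$\alpha=\theta^{2n+1},\qquad F=\sum_{j=1}^n\theta^{2j-1}\wedge\theta^{2j},\qquad \Omega=(\theta^1+i\theta^2)\wedge\dots\wedge(\theta^{2n-1}+i\theta^{2n}).$$ Let $G=\mathrm{SU}(n)\subset \mathrm O(2n+1)$ be the subgroup fixing $\alpha$, $F$, $\Omega$, let $\mathfrak g\subset\mathfrak{gl}(T)$ be its Lie algebra and $A=(\Lambda^*T^*)^{G}$ the algebra of invariant forms. For $\beta\in A$ of degree $p$ let $d\iota(\beta)=-\sum_{i,j}\omega_{ij}\wedge\theta^j\wedge(\theta_i\lrcorner\beta)$, a $(p+1)$-form on $T\oplus\mathfrak{gl}(T)$, where $\theta^j$ and $\omega_{ij}$ are the coordinates on the two summands; this is the value at a point of a frame bundle of the exterior derivative of the horizontal form defined by $\beta$, the structure equation being $d\theta^i=-\sum_j\omega_{ij}\wedge\theta^j$. Let $Z_0\subset \mathfrak{gl}(T)\otimes T$ be the space of those $\eta$, regarded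 as linear maps $T\to\mathfrak{gl}(T)$, such that all $d\iota(\beta)$, $\beta\in A$, vanish on the graph of $\eta$. For a subspace $W\subset T$ let $c(W)$ be the dimension of the space of polar equations of $W\oplus 0$, i.e. the codimension in $T\oplus\mathfrak{gl}(T)$ of $$\{z : d\iota(\beta)(z,w_1,\dots,w_p)=0\ \text{ for all } p,\ \beta\in A\cap\Lambda^pT^*,\ w_1,\dots,w_p\in W\oplus 0\}.$$ A flag $W_0\subsetneq\dots\subsetneq W_{N}=T$ is called $\mathcal I^{G}$-ordinary if $c(W_0)+\dots+c(W_{N-1})=\dim\big((\mathfrak{gl}(T)\otimes T)/Z_0\big)$. The group $G$ is called strongly admissible if the image of $Z_0$ in $(T\otimes\Lambda^2T)/(\mathfrak g\otimes T)$ is zero, equivalently if $Z_0=(\mathfrak g\otimes T)\oplus(T\otimes S^2T)$; here $\mathfrak{gl}(T)\otimes T\to T\otimes\Lambda^2T$ is skew-symmetrization, and $\mathfrak g\otimes T$ in the quotient stands for its image under it. Let $E_0\subsetneq\dots\subsetneq E_{2n+1}$ be the flag $$E_k=\langle\theta_1,\theta_3,\dots,\theta_{2k-1}\rangle\ (0\le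 k\le n),\qquad E_{n+k}=E_n\oplus\langle\theta_2,\theta_4,\dots,\theta_{2k}\rangle\ (1\le k<n),$$ $$E_{2n}=E_{2n-1}\oplus\langle\theta_{2n+1}\rangle,\qquad E_{2n+1}=T.$$ Then: 1. The flag $E_0\subsetneq\dots\subsetneq E_{2n+1}$ is $\mathcal I^{\mathrm{SU}(n)}$-ordinary. 2. $\mathrm{SU}(n)\subset \mathrm O(2n+1)$ is strongly admissible. 3. The intrinsic torsion of an $\mathrm{SU}(n)$-structure is determined by $d\alpha$, $dF$, $d\Omega$: there is a linear map $L$, depending only on $n$, from $\Lambda^2T^*\oplus\Lambda^3T^*\oplus(\Lambda^{n+1}T^*\otimes\mathbb C)$ to $(T\otimes\Lambda^2T)/(\mathfrak g\otimes T)$ such that for every smooth $(2n+1)$-manifold $M$, every $\mathrm{SU}(n)$-structure $P$ on $M$ with defining forms $(\alpha,F,\Omega)$ (the differential forms on $M$ whose components in every frame of $P$ are the forms above) and every frame $u\in P$ at a point $x\in M$, the intrinsic torsion of $P$ at $u$ (the class of the torsion at $u$ of any connection on $P$ near $x$) equals $L(u^*d\alpha,u^*dF,u^*d\Omega)$. 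-/

import Mathlib

open scoped Manifold ContDiff Topology

noncomputable section

namespace OddSU

/-! ### Linear algebra: the model space, invariant forms, the Lie algebra of `G` -/

/-- The Euclidean model space `T = ℝᴺ`. -/
abbrev T (N : ℕ) : Type := EuclideanSpace ℝ (Fin N)

/-- `gl(T)`. -/
abbrev Gl (N : ℕ) : Type := T N →ₗ[ℝ] T N

/-- `gl(T) ⊗ T`, with `T` identified with its dual by the metric: the tensor with components
`p_{ijk}` is the map sending the vector `v` to the endomorphism with matrix `∑ₖ p_{ijk} vₖ`. -/
abbrev GlT (N : ℕ) : Type := T N →ₗ[ℝ] Gl N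

/-- `T ⊗ Λ²T`: alternating two-forms on `T` with values in `T`. -/
abbrev TorsionSpace (N : ℕ) : Type := T N [⋀^Fin 2]→ₗ[ℝ] T N

/-- A linear isometry of `T` as a continuous linear map. -/
def toCLM {N : ℕ} (g : T N ≃ₗᵢ[ℝ] T N) : T N →L[ℝ] T N :=
  (g.toContinuousLinearEquiv : T N →L[ℝ] T N)

/-- The degree `p` part of the algebra `(Λ^*T)^G` of `G`-invariant forms. -/
def invariantForms {N : ℕ} (G : Subgroup (T N ≃ₗᵢ[ℝ] T N)) (p : ℕ) :
    Submodule ℝ (T N [⋀^Fin p]→L[ℝ] ℝ) where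
  carrier := {β | ∀ g ∈ G, β.compContinuousLinearMap (toCLM g) = β}
  add_mem' := by
    intro a b ha hb g hg
    ext v
    have h1 := congrArg (fun f => f v) (ha g hg)
    have h2 := congrArg (fun f => f v) (hb g hg)
    simp at h1 h2 ⊢
    rw [h1, h2]
  zero_mem' := by
    intro g _
    ext v
    simp
  smul_mem' := by
    intro c a ha g hg
    ext v
    have h1 := congrArg (fun f => f v) (ha g hg)
    simp at h1 ⊢
    rw [h1]
    simp

/-- The Lie algebra of a closed subgroup `G ⊂ O(N)`: the endomorphisms `X` of `T` such that
`exp(tX) ∈ G` for all real `t`. (For closed `G` these already form a linear subspace.) -/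
def lieAlg {N : ℕ} (G : Subgroup (T N ≃ₗᵢ[ℝ] T N)) : Submodule ℝ (Gl N) :=
  Submodule.span ℝ {X | ∀ t : ℝ, ∃ g ∈ G,
    toCLM g = NormedSpace.exp (t • LinearMap.toContinuousLinearMap X)}

/-- The infinitesimal action of `X ∈ gl(T)` on a form `β`:
`(v₁, …, v_p) ↦ ∑ᵢ β(v₁, …, X vᵢ, …, v_p)`. -/
def infAct {N p : ℕ} (X : Gl N) (β : T N [⋀^Fin p]→L[ℝ] ℝ) (v : Fin p → T N) : ℝ :=
  ∑ i, β (Function.update v i (X (v i)))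

lemma infAct_add {N p : ℕ} (X Y : Gl N) (β : T N [⋀^Fin p]→L[ℝ] ℝ) (v : Fin p → T N) :
    infAct (X + Y) β v = infAct X β v + infAct Y β v := by
  simp [infAct, Finset.sum_add_distrib]

lemma infAct_smul {N p : ℕ} (c : ℝ) (X : Gl N) (β : T N [⋀^Fin p]→L[ℝ] ℝ) (v : Fin p → T N) :
    infAct (c • X) β v = c * infAct X β v := by
  simp [infAct, Finset.mul_sum]

lemma infAct_zero {N p : ℕ} (β : T N [⋀^Fin p]→L[ℝ] ℝ) (v : Fin p → T N) :
    infAct (0 : Gl N) β v = 0 := by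
  have h := infAct_smul 0 (0 : Gl N) β v
  rwa [zero_smul, zero_mul] at h

/-! ### The exterior differential system generated by an algebra of forms

At a point `u` of the frame bundle `F` of an `N`-manifold, the tautological form `θ` and a
torsion-free connection form `ω` identify `T_u F` with `T × gl(T)`. -/

/-- The value at a point of the frame bundle of `dι(β)`, where `ι` maps `β` to the corresponding
horizontal form. It is determined by the structure equation `dθᵢ = - ∑ⱼ ωᵢⱼ ∧ θⱼ` and the Leibniz
rule, so `dι(β) = - ∑ᵢⱼ ωᵢⱼ ∧ θⱼ ∧ (eᵢ ⌟ β)`. A tangent vector is `z = (θ(z), ω(z))`. -/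
def dTaut {N p : ℕ} (β : T N [⋀^Fin p]→L[ℝ] ℝ) (z : Fin (p + 1) → T N × Gl N) : ℝ :=
  -∑ m : Fin (p + 1), (-1 : ℝ) ^ (m : ℕ) * infAct (z m).2 β (fun i => (z (m.succAbove i)).1)

/-- `Z₀` for the graded algebra `A` (given by its homogeneous parts): those `η ∈ gl(T) ⊗ T` such
that on the transverse `N`-plane `ω = η(θ)` in `T_u F` all the forms `dι(β)`, `β ∈ A`, vanish,
i.e. that plane is an integral element of the ideal generated by `dι(A)`. -/
def Z0 {N : ℕ} (A : ∀ p, Submodule ℝ (T N [⋀^Fin p]→L[ℝ] ℝ)) : Submodule ℝ (GlT N) where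
  carrier := {η | ∀ p, ∀ β ∈ A p, ∀ v : Fin (p + 1) → T N, dTaut β (fun i => (v i, η (v i))) = 0}
  add_mem' := by
    intro a b ha hb p β hβ v
    have h1 := ha p β hβ v
    have h2 := hb p β hβ v
    simp only [dTaut, LinearMap.add_apply, infAct_add, mul_add,
      Finset.sum_add_distrib] at h1 h2 ⊢
    linarith
  zero_mem' := by
    intro p β _ v
    simp [dTaut, infAct_zero]
  smul_mem' := by
    intro c a ha p β hβ v
    have h1 := ha p β hβ v
    simp only [dTaut, LinearMap.smul_apply, infAct_smul, mul_left_comm _ c,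
      ← Finset.mul_sum] at h1 ⊢
    rw [← mul_neg, h1, mul_zero]

lemma infAct_update_add {N p : ℕ} (X : Gl N) (β : T N [⋀^Fin p]→L[ℝ] ℝ) (v : Fin p → T N)
    (j : Fin p) (a b : T N) :
    infAct X β (Function.update v j (a + b)) =
      infAct X β (Function.update v j a) + infAct X β (Function.update v j b) := by
  unfold infAct
  rw [← Finset.sum_add_distrib]
  refine Finset.sum_congr rfl fun i _ => ?_
  by_cases h : i = j
  · subst h; simp
  · simp only [Function.update_of_ne h]
    simp [Function.update_comm (Ne.symm h)]

lemma infAct_update_smul {N p : ℕ} (X : Gl N) (β : T N [⋀^Fin p]→L[ℝ] ℝ) (v : Fin p → T N)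
    (j : Fin p) (c : ℝ) (a : T N) :
    infAct X β (Function.update v j (c • a)) = c * infAct X β (Function.update v j a) := by
  unfold infAct
  rw [Finset.mul_sum]
  refine Finset.sum_congr rfl fun i _ => ?_
  by_cases h : i = j
  · subst h; simp
  · simp only [Function.update_of_ne h]
    simp [Function.update_comm (Ne.symm h)]

lemma dTaut_update_add {N p : ℕ} (β : T N [⋀^Fin p]→L[ℝ] ℝ) (z : Fin (p + 1) → T N × Gl N)
    (j : Fin (p + 1)) (a b : T N × Gl N) :
    dTaut β (Function.update z j (a + b)) =
      dTaut β (Function.update z j a) + dTaut β (Function.update z j b) := by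
  have key : ∀ (m : Fin (p + 1)) (c : T N × Gl N), m ≠ j → ∃ k : Fin p, m.succAbove k = j ∧
      (fun i => (Function.update z j c (m.succAbove i)).1) =
        Function.update (fun i => (z (m.succAbove i)).1) k c.1 := by
    intro m c hm
    obtain ⟨k, hk⟩ := Fin.exists_succAbove_eq (Ne.symm hm)
    refine ⟨k, hk, ?_⟩
    funext i
    by_cases hi : i = k
    · subst hi; simp [hk]
    · have : m.succAbove i ≠ j := fun h => hi (Fin.succAbove_right_injective (h.trans hk.symm))
      simp [Function.update_of_ne, hi, this]
  unfold dTaut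
  rw [← neg_add, ← Finset.sum_add_distrib]
  refine congrArg _ (Finset.sum_congr rfl fun m _ => ?_)
  rw [← mul_add]
  congr 1
  by_cases hm : m = j
  · subst hm
    simp [infAct_add, Fin.succAbove_ne]
  · obtain ⟨k, hk, h1⟩ := key m (a + b) hm
    obtain ⟨k', hk', h2⟩ := key m a hm
    obtain ⟨k'', hk'', h3⟩ := key m b hm
    have e1 : k' = k := Fin.succAbove_right_injective (hk'.trans hk.symm)
    have e2 : k'' = k := Fin.succAbove_right_injective (hk''.trans hk.symm)
    subst e1; subst e2
    rw [h1, h2, h3]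
    simp [Function.update_of_ne hm, infAct_update_add]

lemma dTaut_update_smul {N p : ℕ} (β : T N [⋀^Fin p]→L[ℝ] ℝ) (z : Fin (p + 1) → T N × Gl N)
    (j : Fin (p + 1)) (c : ℝ) (a : T N × Gl N) :
    dTaut β (Function.update z j (c • a)) = c * dTaut β (Function.update z j a) := by
  have key : ∀ (m : Fin (p + 1)) (c : T N × Gl N), m ≠ j → ∃ k : Fin p, m.succAbove k = j ∧
      (fun i => (Function.update z j c (m.succAbove i)).1) =
        Function.update (fun i => (z (m.succAbove i)).1) k c.1 := by
    intro m c hm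
    obtain ⟨k, hk⟩ := Fin.exists_succAbove_eq (Ne.symm hm)
    refine ⟨k, hk, ?_⟩
    funext i
    by_cases hi : i = k
    · subst hi; simp [hk]
    · have : m.succAbove i ≠ j := fun h => hi (Fin.succAbove_right_injective (h.trans hk.symm))
      simp [Function.update_of_ne, hi, this]
  unfold dTaut
  rw [mul_neg, Finset.mul_sum]
  refine congrArg _ (Finset.sum_congr rfl fun m _ => ?_)
  rw [mul_left_comm]
  congr 1
  by_cases hm : m = j
  · subst hm
    simp [infAct_smul, Fin.succAbove_ne]
  · obtain ⟨k, hk, h1⟩ := key m (c • a) hm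
    obtain ⟨k', hk', h2⟩ := key m a hm
    have e1 : k' = k := Fin.succAbove_right_injective (hk'.trans hk.symm)
    subst e1
    rw [h1, h2]
    simp [Function.update_of_ne hm, infAct_update_smul]

/-- The polar space `H(E) ⊂ T_u F` of an integral element `E` of the ideal generated by `dι(A)`:
the common kernel of the polar equations `z ↦ dι(β)(z, e₁, …, e_p)`, `β ∈ A` of degree `p` and
`e₁, …, e_p ∈ E`. (Since the generators vanish on `E`, the other elements of the ideal give only
linear combinations of these equations.) -/
def polarSpace {N : ℕ} (A : ∀ p, Submodule ℝ (T N [⋀^Fin p]→L[ℝ] ℝ))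
    (E : Submodule ℝ (T N × Gl N)) : Submodule ℝ (T N × Gl N) where
  carrier := {z | ∀ p, ∀ β ∈ A p, ∀ e : Fin p → T N × Gl N, (∀ i, e i ∈ E) →
    dTaut β (Fin.cons z e) = 0}
  add_mem' := by
    intro a b ha hb p β hβ e he
    have h := dTaut_update_add β (Fin.cons 0 e : Fin (p + 1) → T N × Gl N) 0 a b
    simp only [Fin.update_cons_zero] at h
    rw [h, ha p β hβ e he, hb p β hβ e he, add_zero]
  zero_mem' := by
    intro p β _ e _
    have h := dTaut_update_smul β (Fin.cons 0 e : Fin (p + 1) → T N × Gl N) 0 0 0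
    rw [zero_smul, zero_mul, Fin.update_cons_zero] at h
    exact h
  smul_mem' := by
    intro c a ha p β hβ e he
    have h := dTaut_update_smul β (Fin.cons 0 e : Fin (p + 1) → T N × Gl N) 0 c a
    simp only [Fin.update_cons_zero] at h
    rw [h, ha p β hβ e he, mul_zero]

/-- `c(W)`: the dimension of the space of polar equations of the integral element corresponding to
`W ⊂ T`, i.e. `dim T_u F - dim H(E')` where `E' = W × 0` is contained in the integral element
`T × 0` (the plane `ω = 0`). -/
def polarRank {N : ℕ} (A : ∀ p, Submodule ℝ (T N [⋀^Fin p]→L[ℝ] ℝ))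
    (W : Submodule ℝ (T N)) : ℕ :=
  Module.finrank ℝ (T N × Gl N) - Module.finrank ℝ (polarSpace A (W.prod ⊥))

/-- A flag `W₀ ⊊ ⋯ ⊊ W_N = T` is `𝓘_A`-ordinary if
`c(W₀) + ⋯ + c(W_{N-1}) = dim (gl(T) ⊗ T) / Z₀`. -/
def IsOrdinaryFlag {N : ℕ} (A : ∀ p, Submodule ℝ (T N [⋀^Fin p]→L[ℝ] ℝ))
    (W : Fin (N + 1) → Submodule ℝ (T N)) : Prop :=
  StrictMono W ∧ W (Fin.last N) = ⊤ ∧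
    ∑ k : Fin N, polarRank A (W k.castSucc) = Module.finrank ℝ (GlT N ⧸ Z0 A)

/-- The skew-symmetrization `gl(T) ⊗ T → T ⊗ Λ²T`, `η ↦ ((v, w) ↦ η(v) w - η(w) v)`; for the
connection `ω + η` it is the contribution `η ∧ θ` to the torsion. -/
def skew (N : ℕ) : GlT N →ₗ[ℝ] TorsionSpace N where
  toFun η :=
    { toFun := fun v => η (v 0) (v 1) - η (v 1) (v 0)
      map_update_add' := by
        intro inst v i x y
        obtain rfl := Subsingleton.elim inst (instDecidableEqFin 2)
        fin_cases i <;> simp <;> abel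
      map_update_smul' := by
        intro inst v i c x
        obtain rfl := Subsingleton.elim inst (instDecidableEqFin 2)
        fin_cases i <;> simp [smul_sub]
      map_eq_zero_of_eq' := by
        intro v i j h hij
        fin_cases i <;> fin_cases j <;> simp_all }
  map_add' := by
    intro a b
    ext1 v
    change (a + b) (v 0) (v 1) - (a + b) (v 1) (v 0) =
      (a (v 0) (v 1) - a (v 1) (v 0)) + (b (v 0) (v 1) - b (v 1) (v 0))
    simp only [LinearMap.add_apply]
    abel
  map_smul' := by
    intro c a
    ext1 v
    change (c • a) (v 0) (v 1) - (c • a) (v 1) (v 0) = c • (a (v 0) (v 1) - a (v 1) (v 0))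
    simp only [LinearMap.smul_apply, smul_sub]

/-- `V ⊗ T ⊂ gl(T) ⊗ T` for a subspace `V` of `gl(T)`. -/
def tensorT {N : ℕ} (V : Submodule ℝ (Gl N)) : Submodule ℝ (GlT N) where
  carrier := {η | ∀ v, η v ∈ V}
  add_mem' := fun ha hb v => V.add_mem (ha v) (hb v)
  zero_mem' := fun _ => V.zero_mem
  smul_mem' := fun c _ ha v => V.smul_mem c (ha v)

/-- `T ⊗ S²T ⊂ gl(T) ⊗ T`: the tensors `p_{ijk}` symmetric in `j, k`. -/
def symT (N : ℕ) : Submodule ℝ (GlT N) where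
  carrier := {η | ∀ v w, η v w = η w v}
  add_mem' := fun ha hb v w => by simp [ha v w, hb v w]
  zero_mem' := fun _ _ => by simp
  smul_mem' := fun c _ ha v w => by simp [ha v w]

/-- The space `(T ⊗ Λ²T) / (𝔤 ⊗ T)` in which the intrinsic torsion of `G`-structures lies, where
`𝔤 ⊗ T` stands for its image under skew-symmetrization. -/
abbrev IntrinsicTorsionSpace {N : ℕ} (G : Subgroup (T N ≃ₗᵢ[ℝ] T N)) : Type :=
  TorsionSpace N ⧸ (tensorT (lieAlg G)).map (skew N)

/-- `Z₀''`: the image of `Z₀` in `(T ⊗ Λ²T) / (𝔤 ⊗ T)`, for `A = (Λ^*T)^G`. -/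
def Z0'' {N : ℕ} (G : Subgroup (T N ≃ₗᵢ[ℝ] T N)) : Submodule ℝ (IntrinsicTorsionSpace G) :=
  ((Z0 (invariantForms G)).map (skew N)).map (Submodule.mkQ _)

/-- `G` is strongly admissible: `Z₀'' = {0}` and `Z₀ = (𝔤 ⊗ T) ⊕ (T ⊗ S²T)`. (The two conditions
are equivalent; both are recorded.) -/
def StronglyAdmissible {N : ℕ} (G : Subgroup (T N ≃ₗᵢ[ℝ] T N)) : Prop :=
  Z0'' G = ⊥ ∧
    (Disjoint (tensorT (lieAlg G)) (symT N) ∧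
      Z0 (invariantForms G) = tensorT (lieAlg G) ⊔ symT N)

/-! ### `SU(n)` acting on `ℝ^{2n+1}` and the explicit flag

Coordinates are indexed from `0`: the basis vector `θ_{i+1}` has index `i`. -/

/-- The real coordinate of index `i`, zero if `i` is out of range. -/
def coord (N i : ℕ) : T N →L[ℝ] ℝ :=
  if h : i < N then EuclideanSpace.proj (⟨i, h⟩ : Fin N) else 0

/-- The complex coordinates `z_j = θ^{2j-1} + i θ^{2j}`, `1 ≤ j ≤ n`, on `ℝ^{2n+1}`. -/
def zCoord (n : ℕ) (j : Fin n) : T (2 * n + 1) →L[ℝ] ℂ :=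
  Complex.ofRealCLM.comp (coord (2 * n + 1) (2 * j)) +
    Complex.I • Complex.ofRealCLM.comp (coord (2 * n + 1) (2 * j + 1))

/-- `α = θ^{2n+1}`. -/
def alpha₀ (n : ℕ) : T (2 * n + 1) [⋀^Fin 1]→L[ℝ] ℝ :=
  ContinuousAlternatingMap.ofSubsingleton ℝ _ _ (0 : Fin 1) (coord (2 * n + 1) (2 * n))

/-- `F = θ^{12} + ⋯ + θ^{2n-1,2n}`. -/
def F₀ (n : ℕ) : T (2 * n + 1) [⋀^Fin 2]→L[ℝ] ℝ where
  toFun v := ∑ j : Fin n,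
    (coord (2 * n + 1) (2 * j) (v 0) * coord (2 * n + 1) (2 * j + 1) (v 1) -
      coord (2 * n + 1) (2 * j) (v 1) * coord (2 * n + 1) (2 * j + 1) (v 0))
  map_update_add' := by
    intro inst v i x y
    obtain rfl := Subsingleton.elim inst (instDecidableEqFin 2)
    rw [← Finset.sum_add_distrib]
    refine Finset.sum_congr rfl fun j _ => ?_
    fin_cases i <;> simp <;> ring
  map_update_smul' := by
    intro inst v i c x
    obtain rfl := Subsingleton.elim inst (instDecidableEqFin 2)
    rw [smul_eq_mul, Finset.mul_sum]
    refine Finset.sum_congr rfl fun j _ => ?_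
    fin_cases i <;> simp <;> ring
  cont := by fun_prop
  map_eq_zero_of_eq' := by
    intro v i j h hij
    refine Finset.sum_eq_zero fun k _ => ?_
    fin_cases i <;> fin_cases j <;> simp_all

/-- All the complex coordinates at once, `ℝ^{2n+1} → ℂⁿ`. -/
def zMap (n : ℕ) : T (2 * n + 1) →ₗ[ℝ] (Fin n → ℂ) :=
  LinearMap.pi fun j => (zCoord n j : T (2 * n + 1) →ₗ[ℝ] ℂ)

/-- `Ω = (θ¹ + iθ²) ∧ ⋯ ∧ (θ^{2n-1} + iθ^{2n})`, i.e.
`Ω(v₁, …, v_n) = det (z_j(v_k))`. -/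
def Omega₀ (n : ℕ) : T (2 * n + 1) [⋀^Fin n]→L[ℝ] ℂ where
  toFun v := Matrix.det (Matrix.of fun k j => zCoord n j (v k))
  map_update_add' := by
    intro inst v i x y
    have h := ((Matrix.detRowAlternating (R := ℂ) (n := Fin n)).map_update_add
      (fun k => zMap n (v k)) i (zMap n x) (zMap n y))
    rw [← map_add] at h
    obtain rfl := Subsingleton.elim inst (instDecidableEqFin n)
    have e : ∀ w : T (2 * n + 1), Function.update (fun k => zMap n (v k)) i (zMap n w) =
        fun k => zMap n (Function.update v i w k) := by
      intro w
      funext k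
      by_cases hk : k = i
      · subst hk; simp
      · simp [Function.update_of_ne hk]
    rw [e, e, e] at h
    exact h
  map_update_smul' := by
    intro inst v i c x
    have h := ((Matrix.detRowAlternating (R := ℂ) (n := Fin n)).map_update_smul
      (fun k => zMap n (v k)) i (c : ℂ) (zMap n x))
    rw [show (c : ℂ) • zMap n x = zMap n (c • x) by rw [map_smul]; rfl] at h
    obtain rfl := Subsingleton.elim inst (instDecidableEqFin n)
    have e : ∀ w : T (2 * n + 1), Function.update (fun k => zMap n (v k)) i (zMap n w) =
        fun k => zMap n (Function.update v i w k) := by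
      intro w
      funext k
      by_cases hk : k = i
      · subst hk; simp
      · simp [Function.update_of_ne hk]
    rw [e, e] at h
    exact h
  cont := by
    refine Continuous.matrix_det (continuous_matrix fun k j => ?_)
    exact (zCoord n j).continuous.comp (continuous_apply k)
  map_eq_zero_of_eq' := by
    intro v i j h hij
    refine Matrix.det_zero_of_row_eq hij ?_
    funext k
    simp [h]

/-- `SU(n)` as the subgroup of `O(2n+1)` fixing `α`, `F` and `Ω`. -/
def SU (n : ℕ) : Subgroup (T (2 * n + 1) ≃ₗᵢ[ℝ] T (2 * n + 1)) where
  carrier := {g | (alpha₀ n).compContinuousLinearMap (toCLM g) = alpha₀ n ∧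
    (F₀ n).compContinuousLinearMap (toCLM g) = F₀ n ∧
    (Omega₀ n).compContinuousLinearMap (toCLM g) = Omega₀ n}
  mul_mem' := by
    rintro a b ⟨a1, a2, a3⟩ ⟨b1, b2, b3⟩
    refine ⟨?_, ?_, ?_⟩
    · conv_rhs => rw [← b1, ← a1]
      rfl
    · conv_rhs => rw [← b2, ← a2]
      rfl
    · conv_rhs => rw [← b3, ← a3]
      rfl
  one_mem' := ⟨rfl, rfl, rfl⟩
  inv_mem' := by
    rintro a ⟨a1, a2, a3⟩
    have h : (toCLM a).comp (toCLM a⁻¹) = ContinuousLinearMap.id ℝ _ := by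
      ext1 v
      exact a.apply_symm_apply v
    have key : ∀ {p : ℕ} {V : Type} [NormedAddCommGroup V] [NormedSpace ℝ V]
        (β : T (2 * n + 1) [⋀^Fin p]→L[ℝ] V), β.compContinuousLinearMap (toCLM a) = β →
        β.compContinuousLinearMap (toCLM a⁻¹) = β := by
      intro p V _ _ β hβ
      conv_lhs => rw [← hβ]
      ext v
      have : ∀ w, toCLM a (toCLM a⁻¹ w) = w := fun w => a.apply_symm_apply w
      simp [Function.comp_def, this]
    exact ⟨key _ a1, key _ a2, key _ a3⟩

/-- The span of the basis vectors whose (zero-based) index satisfies `s`. -/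
def coordSpan (N : ℕ) (s : ℕ → Prop) : Submodule ℝ (T N) :=
  Submodule.span ℝ {x | ∃ i : Fin N, s i ∧ x = EuclideanSpace.single i (1 : ℝ)}

/-- The explicit flag in `ℝ^{2n+1}`:
`E_k = ⟨θ₁, θ₃, …, θ_{2k-1}⟩` for `0 ≤ k ≤ n`,
`E_{n+k} = E_n ⊕ ⟨θ₂, θ₄, …, θ_{2k}⟩` for `1 ≤ k < n`,
`E_{2n} = E_{2n-1} ⊕ ⟨θ_{2n+1}⟩` and `E_{2n+1} = T`. -/
def flag (n : ℕ) (k : Fin (2 * n + 1 + 1)) : Submodule ℝ (T (2 * n + 1)) :=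
  if (k : ℕ) ≤ n then coordSpan _ (fun i => ∃ j < (k : ℕ), i = 2 * j)
  else if (k : ℕ) < 2 * n then
    coordSpan _ (fun i => ∃ j < n, i = 2 * j) ⊔
      coordSpan _ (fun i => ∃ j < (k : ℕ) - n, i = 2 * j + 1)
  else if (k : ℕ) = 2 * n then
    coordSpan _ (fun i => ∃ j < n, i = 2 * j) ⊔
      coordSpan _ (fun i => ∃ j < n - 1, i = 2 * j + 1) ⊔
      coordSpan _ (fun i => i = 2 * n)
  else ⊤

/-! ### Differential forms, `G`-structures and intrinsic torsion on manifolds -/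

section Manifold

variable {N : ℕ} {M : Type*} [TopologicalSpace M] [ChartedSpace (T N) M]

/-- A differential `p`-form on `M` with values in `V`. -/
abbrev DForm (N : ℕ) (M : Type*) [TopologicalSpace M] [ChartedSpace (T N) M] (p : ℕ)
    (V : Type*) [NormedAddCommGroup V] [NormedSpace ℝ V] : Type _ :=
  ∀ x : M, TangentSpace 𝓘(ℝ, T N) x [⋀^Fin p]→L[ℝ] V

/-- The expression of a differential form in the preferred chart at `x`: its pull-back under the
inverse of the chart. -/
def chartRep {p : ℕ} {V : Type*} [NormedAddCommGroup V] [NormedSpace ℝ V]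
    (b : DForm N M p V) (x : M) : T N → T N [⋀^Fin p]→L[ℝ] V := fun y =>
  (b ((extChartAt 𝓘(ℝ, T N) x).symm y)).compContinuousLinearMap
    (mfderiv 𝓘(ℝ, T N) 𝓘(ℝ, T N) (extChartAt 𝓘(ℝ, T N) x).symm y)

/-- The exterior derivative of a differential form, computed in charts. -/
def extD {p : ℕ} {V : Type*} [NormedAddCommGroup V] [NormedSpace ℝ V]
    (b : DForm N M p V) : DForm N M (p + 1) V := fun x =>
  (extDeriv (chartRep b x) (extChartAt 𝓘(ℝ, T N) x x)).compContinuousLinearMap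
    (mfderiv 𝓘(ℝ, T N) 𝓘(ℝ, T N) (extChartAt 𝓘(ℝ, T N) x) x)

/-- A frame at `x`, i.e. a linear isomorphism `T → T_x M`. -/
abbrev Frame (N : ℕ) {M : Type*} [TopologicalSpace M] [ChartedSpace (T N) M] (x : M) : Type _ :=
  T N ≃L[ℝ] TangentSpace 𝓘(ℝ, T N) x

/-- The field of frames `s` is smooth near `x`: for each `v ∈ T`, the vector field `y ↦ s_y(v)`
is smooth near `x`. -/
def SmoothFrameAt (s : ∀ y : M, Frame N y) (x : M) [IsManifold 𝓘(ℝ, T N) ∞ M] : Prop :=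
  ∀ᶠ y in 𝓝 x, ∀ v : T N, ContMDiffAt 𝓘(ℝ, T N) 𝓘(ℝ, T N).tangent ∞
    (fun y' => (⟨y', s y' v⟩ : TangentBundle 𝓘(ℝ, T N) M)) y

/-- A `G`-structure on `M`: a smooth reduction of the frame bundle to `G`. -/
structure GStructure (G : Subgroup (T N ≃ₗᵢ[ℝ] T N)) (M : Type*) [TopologicalSpace M]
    [ChartedSpace (T N) M] [IsManifold 𝓘(ℝ, T N) ∞ M] where
  /-- the frames at `x` belonging to the structure -/
  frames : ∀ x : M, Set (Frame N x)
  /-- each fibre is an orbit of `G`, acting by `u ↦ u ∘ g` -/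
  mem_iff : ∀ (x : M) (u : Frame N x), u ∈ frames x → ∀ u' : Frame N x,
    u' ∈ frames x ↔ ∃ g ∈ G, u' = g.toContinuousLinearEquiv.trans u
  /-- there are smooth local sections around every point -/
  exists_section : ∀ x : M, ∃ s : ∀ y : M, Frame N y,
    SmoothFrameAt s x ∧ ∀ᶠ y in 𝓝 x, s y ∈ frames y

variable [IsManifold 𝓘(ℝ, T N) ∞ M] {G : Subgroup (T N ≃ₗᵢ[ℝ] T N)}

lemma GStructure.nonempty (P : GStructure G M) (x : M) : ∃ u, u ∈ P.frames x := by
  obtain ⟨s, -, h⟩ := P.exists_section x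
  exact ⟨s x, h.self_of_nhds⟩

/-- The differential form on `M` determined by a `G`-structure and a `G`-invariant form `β` on `T`:
at `x` it is `(u⁻¹)^*β` for any frame `u` of the structure at `x`
(see `GStructure.form_comp_frame`). -/
def GStructure.form {p : ℕ} {V : Type*} [NormedAddCommGroup V] [NormedSpace ℝ V]
    (P : GStructure G M) (β : T N [⋀^Fin p]→L[ℝ] V) : DForm N M p V := fun x =>
  β.compContinuousLinearMap
    ((P.nonempty x).choose.symm : TangentSpace 𝓘(ℝ, T N) x →L[ℝ] T N)

lemma GStructure.form_comp_frame {p : ℕ} {V : Type*} [NormedAddCommGroup V] [NormedSpace ℝ V]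
    (P : GStructure G M) (β : T N [⋀^Fin p]→L[ℝ] V)
    (hβ : ∀ g ∈ G, β.compContinuousLinearMap (toCLM g) = β) (x : M) (u : Frame N x)
    (hu : u ∈ P.frames x) :
    (P.form β x).compContinuousLinearMap (u : T N →L[ℝ] TangentSpace 𝓘(ℝ, T N) x) = β := by
  obtain ⟨g, hg, rfl⟩ := (P.mem_iff x _ (P.nonempty x).choose_spec u).1 hu
  conv_rhs => rw [← hβ g hg]
  ext v
  simp [GStructure.form, toCLM, Function.comp_def]

/-- The coframe dual to a field of frames, i.e. the `T`-valued one-form `s^*θ`. -/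
def coframe (s : ∀ y : M, Frame N y) : DForm N M 1 (T N) := fun y =>
  ContinuousAlternatingMap.ofSubsingleton ℝ _ _ (0 : Fin 1)
    ((s y).symm : TangentSpace 𝓘(ℝ, T N) y →L[ℝ] T N)

/-- A connection on a `G`-structure near `x`, given by a smooth local section `s` of the structure
and the pull-back `a = s^*ω` of the connection form, a smooth one-form with values in `𝔤`. -/
structure LocalConnection (P : GStructure G M) (x : M) where
  s : ∀ y : M, Frame N y
  smooth_s : SmoothFrameAt s x
  s_mem : ∀ᶠ y in 𝓝 x, s y ∈ P.frames y
  a : ∀ y : M, TangentSpace 𝓘(ℝ, T N) y →ₗ[ℝ] Gl N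
  smooth_a : ∀ᶠ y in 𝓝 x, ∀ v w : T N,
    ContMDiffAt 𝓘(ℝ, T N) 𝓘(ℝ, T N) ∞ (fun y' => a y' (s y' v) w) y
  a_mem : ∀ᶠ y in 𝓝 x, ∀ w, a y w ∈ lieAlg G

/-- The torsion `Θ = dθ + ω ∧ θ` of a connection at the frame `s x`, as an element of `T ⊗ Λ²T`. -/
def LocalConnection.torsion {P : GStructure G M} {x : M} (c : LocalConnection P x) :
    TorsionSpace N :=
  ((extD (coframe c.s) x).compContinuousLinearMap
      (c.s x : T N →L[ℝ] TangentSpace 𝓘(ℝ, T N) x)).toAlternatingMap +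
    skew N ((c.a x).comp (c.s x).toLinearEquiv.toLinearMap)

/-- `τ` is the value at the frame `u` of the intrinsic torsion map of `P`: there are connections on
`P` near `x`, in a local section through `u`, and the torsion at `u` of each of them has class `τ`
in `(T ⊗ Λ²T) / (𝔤 ⊗ T)`. -/
def GStructure.IsIntrinsicTorsion (P : GStructure G M) (x : M) (u : Frame N x)
    (τ : IntrinsicTorsionSpace G) : Prop :=
  (∃ c : LocalConnection P x, c.s x = u) ∧
    ∀ c : LocalConnection P x, c.s x = u → Submodule.Quotient.mk c.torsion = τ

/-- The components in the frame `u` at `x` of the value at `x` of a differential form. -/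
def inFrame {p : ℕ} {V : Type*} [NormedAddCommGroup V] [NormedSpace ℝ V]
    (b : DForm N M p V) {x : M} (u : Frame N x) : T N [⋀^Fin p]→L[ℝ] V :=
  (b x).compContinuousLinearMap (u : T N →L[ℝ] TangentSpace 𝓘(ℝ, T N) x)

end Manifold

end OddSU

end

/-!
Fix `A`, the algebra of invariant forms of `SU(n)`, and write `E_k` for the flag and `e_k` for the
vector added at step `k`. Two facts hold for any `G`: the subspace `(𝔤 ⊗ T) ⊕ (T ⊗ S²T)`
(`trivialTensors`) is contained in `Z₀`, because `𝔤` annihilates invariant forms and because a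
symmetric tensor is the second derivative of a change of coordinates, which commutes with `d`; and
the polar equations of `W ⊕ 0` say that the `gl(T)`-component `X` of a vector annihilates the
restrictions to `W` of the forms of `A` (`polarSpace_prod_bot`).

The core of the proof is `exists_trivialTensor`: if `X ∈ gl(T)` annihilates the restrictions of `α`,
`F`, `Ω` to `E_k`, then some `η` in `(𝔤 ⊗ T) ⊕ (T ⊗ S²T)` vanishes on `E_k` and takes the value `X` on
`e_k`. The symmetric part can be adjusted freely as long as it is consistently prescribed on
`E_{k+1}`, so it suffices to write `X` on `E_k` as the skew-symmetrization of some `γ ∈ 𝔤 ⊗ T`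
(`exists_trivialTensor_of_skew`). In the complex coordinates the polar equations turn `X` into
`S + r` with `S ∈ su(n)` and `r` real symmetric. While the flag is real, `r` is absorbed by real
rotations in the planes containing the new vector. Once the flag contains the Lagrangian subspace
`E_n`, the equations of `Ω` make `X` complex linear of trace zero, and `r` is absorbed by `i t`, where
`t` is a traceless totally symmetric cubic tensor contracting to `r`. At the last two steps `r = 0`.

Correcting an element `η` of `gl(T) ⊗ T` step by step along the flag shows that, if `dα`, `dF`, `dΩ`
vanish on its graph, it lies in `(𝔤 ⊗ T) ⊕ (T ⊗ S²T)` (`ker_derivativeMap`). Hence `Z₀` equals this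
space, which is strong admissibility. Filtering `Z₀` by vanishing on `E_k`, the graded pieces are
exactly the solution spaces of the polar equations, and counting dimensions gives ordinarity
(`IsAdaptedFlag.finrank_eq_sum`). Finally, in a local section of a `G`-structure the derivative of
the coframe is an element `η` of `gl(T) ⊗ T` whose skew-symmetrization represents the intrinsic
torsion (`LocalConnection.mk_torsion`), while `(dα, dF, dΩ)` is a linear function of `η` whose kernel
has just been computed, so the torsion class factors through it.
-/

noncomputable section

namespace OddSU

/-! ### The action of `gl(T)` on forms -/

section Action

variable {N p : ℕ} {V : Type*} [NormedAddCommGroup V] [NormedSpace ℝ V]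

/-- The infinitesimal action of `gl(T)` on vector-valued forms, as a linear map in the
endomorphism; for real-valued forms this is `infAct`. -/
def act (β : T N [⋀^Fin p]→L[ℝ] V) : Gl N →ₗ[ℝ] T N [⋀^Fin p]→L[ℝ] V :=
  (β.fderivCompContinuousLinearMap (.id ℝ (T N))).toLinearMap ∘ₗ
    LinearMap.toContinuousLinearMap.toLinearMap

lemma act_apply (β : T N [⋀^Fin p]→L[ℝ] V) (X : Gl N) (v : Fin p → T N) :
    act β X v = ∑ i, β (Function.update v i (X (v i))) := by
  simp only [act, LinearMap.comp_apply, ContinuousLinearMap.coe_coe,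
    ContinuousAlternatingMap.fderivCompContinuousLinearMap_apply]
  refine Finset.sum_congr rfl fun i _ => congrArg β (funext fun j => ?_)
  by_cases h : j = i
  · subst h; simp
  · simp [Function.update_of_ne h]

lemma infAct_eq_act (β : T N [⋀^Fin p]→L[ℝ] ℝ) (X : Gl N) (v : Fin p → T N) :
    infAct X β v = act β X v := (act_apply β X v).symm

lemma act_compContinuousAlternatingMap {V' : Type*} [NormedAddCommGroup V'] [NormedSpace ℝ V']
    (f : V →L[ℝ] V') (β : T N [⋀^Fin p]→L[ℝ] V) (X : Gl N) (v : Fin p → T N) :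
    act (f.compContinuousAlternatingMap β) X v = f (act β X v) := by
  simp [act_apply]

/-- The continuous bilinear map underlying an element of `gl(T) ⊗ T`. -/
def toBilin (η : GlT N) : T N →L[ℝ] T N →L[ℝ] T N :=
  LinearMap.toContinuousLinearMap (LinearMap.toContinuousLinearMap.toLinearMap ∘ₗ η)

@[simp] lemma toBilin_apply (η : GlT N) (v w : T N) : toBilin η v w = η v w := rfl

/-- The form `(v₀, …, v_p) ↦ ∑ₘ (-1)^m (η(vₘ)·β)(v₀, …, v̂ₘ, …, v_p)`, i.e. `-dι(β)` restricted to
the graph of `η`. -/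
def gradAct (β : T N [⋀^Fin p]→L[ℝ] V) : GlT N →ₗ[ℝ] T N [⋀^Fin (p + 1)]→L[ℝ] V where
  toFun η := .alternatizeUncurryFin
    (β.fderivCompContinuousLinearMap (.id ℝ (T N)) ∘L toBilin η)
  map_add' η ζ := by
    rw [← ContinuousAlternatingMap.alternatizeUncurryFin_add, ← ContinuousLinearMap.comp_add]
    rfl
  map_smul' c η := by
    rw [RingHom.id_apply, ← ContinuousAlternatingMap.alternatizeUncurryFin_smul,
      ← ContinuousLinearMap.comp_smul]
    rfl

lemma gradAct_apply (β : T N [⋀^Fin p]→L[ℝ] V) (η : GlT N) (v : Fin (p + 1) → T N) :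
    gradAct β η v = ∑ m : Fin (p + 1), (-1 : ℤ) ^ (m : ℕ) • act β (η (v m)) (m.removeNth v) := by
  change ContinuousAlternatingMap.alternatizeUncurryFin _ v = _
  rw [ContinuousAlternatingMap.alternatizeUncurryFin_apply]
  rfl

lemma dTaut_graph (β : T N [⋀^Fin p]→L[ℝ] ℝ) (η : GlT N) (v : Fin (p + 1) → T N) :
    dTaut β (fun i => (v i, η (v i))) = -gradAct β η v := by
  rw [gradAct_apply]
  simp only [dTaut, infAct_eq_act, zsmul_eq_mul]
  push_cast
  rfl

lemma gradAct_compContinuousAlternatingMap {V' : Type*} [NormedAddCommGroup V']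
    [NormedSpace ℝ V'] (f : V →L[ℝ] V') (β : T N [⋀^Fin p]→L[ℝ] V) (η : GlT N) :
    gradAct (f.compContinuousAlternatingMap β) η =
      f.compContinuousAlternatingMap (gradAct β η) := by
  ext v
  simp [gradAct_apply, act_compContinuousAlternatingMap]

/-- A symmetric `η` is the second derivative of a change of coordinates, which commutes with `d`. -/
lemma gradAct_eq_zero_of_mem_symT (β : T N [⋀^Fin p]→L[ℝ] V) {η : GlT N} (h : η ∈ symT N) :
    gradAct β η = 0 :=
  ContinuousAlternatingMap.alternatizeUncurryFin_fderivCompContinuousLinearMap_eq_zero β _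
    (fun x y => h x y)

lemma gradAct_eq_zero_of_act (β : T N [⋀^Fin p]→L[ℝ] V) {η : GlT N}
    (h : ∀ v, act β (η v) = 0) : gradAct β η = 0 := by
  ext v
  simp [gradAct_apply, h]

/-- `z ↦ dι(β)(z, (w₁, 0), …, (w_p, 0))` only sees the `gl(T)`-component of `z`. -/
lemma dTaut_cons (β : T N [⋀^Fin p]→L[ℝ] ℝ) (z : T N × Gl N) (e : Fin p → T N × Gl N)
    (he : ∀ i, (e i).2 = 0) :
    dTaut β (Fin.cons z e) = -act β z.2 (fun i => (e i).1) := by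
  rw [dTaut, Fin.sum_univ_succ]
  simp [he, infAct_eq_act]

lemma exp_zero_smul_eq_one (X : Gl N) :
    NormedSpace.exp ((0 : ℝ) • LinearMap.toContinuousLinearMap X) = 1 := by
  have h : (0 : ℝ) • LinearMap.toContinuousLinearMap X = 0 := by
    ext1 v
    simp
  rw [h, NormedSpace.exp_zero]

lemma compContinuousLinearMap_one (β : T N [⋀^Fin p]→L[ℝ] V) :
    β.compContinuousLinearMap (1 : T N →L[ℝ] T N) = β := rfl

lemma hasDerivAt_compContinuousLinearMap_exp (β : T N [⋀^Fin p]→L[ℝ] V) (X : Gl N) (t : ℝ) :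
    HasDerivAt (fun t : ℝ => β.compContinuousLinearMap
        (NormedSpace.exp (t • LinearMap.toContinuousLinearMap X)))
      ((act β X).compContinuousLinearMap
        (NormedSpace.exp (t • LinearMap.toContinuousLinearMap X))) t := by
  have h1 := (hasDerivAt_exp_smul_const' (𝕂 := ℝ) (LinearMap.toContinuousLinearMap X) t).hasFDerivAt
  have h2 := (hasFDerivAt_const (𝕜 := ℝ) β t).continuousAlternatingMapCompContinuousLinearMap h1
  convert! h2.hasDerivAt using 1
  ext v
  simp [act_apply]
  refine Finset.sum_congr rfl fun i _ => congrArg β (funext fun j => ?_)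
  by_cases h : j = i
  · subst h; simp
  · simp [Function.update_of_ne h]

/-- If `X` annihilates `β`, then `exp(tX)` preserves `β`. -/
lemma compContinuousLinearMap_exp_of_act_eq_zero (β : T N [⋀^Fin p]→L[ℝ] V) (X : Gl N)
    (h : act β X = 0) (t : ℝ) :
    β.compContinuousLinearMap (NormedSpace.exp (t • LinearMap.toContinuousLinearMap X)) = β := by
  have hd := fun t => hasDerivAt_compContinuousLinearMap_exp β X t
  have h0 : ∀ t, deriv (fun t : ℝ => β.compContinuousLinearMap
        (NormedSpace.exp (t • LinearMap.toContinuousLinearMap X))) t = 0 := by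
    intro t
    rw [(hd t).deriv, h]
    ext v
    simp
  have := is_const_of_deriv_eq_zero (fun t => (hd t).differentiableAt) h0 t 0
  simp only [exp_zero_smul_eq_one, compContinuousLinearMap_one] at this
  exact this

/-- The Lie algebra of `G` annihilates the `G`-invariant forms. -/
lemma act_eq_zero_of_mem_lieAlg {G : Subgroup (T N ≃ₗᵢ[ℝ] T N)} {β : T N [⋀^Fin p]→L[ℝ] V}
    (hβ : ∀ g ∈ G, β.compContinuousLinearMap (toCLM g) = β) {X : Gl N} (hX : X ∈ lieAlg G) :
    act β X = 0 := by
  have hle : lieAlg G ≤ LinearMap.ker (act β) := by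
    refine Submodule.span_le.2 fun X hX => ?_
    have h0 := hasDerivAt_compContinuousLinearMap_exp β X 0
    have h1 : (fun t : ℝ => β.compContinuousLinearMap
        (NormedSpace.exp (t • LinearMap.toContinuousLinearMap X))) = fun _ => β := by
      funext t
      obtain ⟨g, hg, hgt⟩ := hX t
      rw [← hgt, hβ g hg]
    rw [h1] at h0
    have h2 := h0.unique (hasDerivAt_const 0 β)
    rwa [exp_zero_smul_eq_one, compContinuousLinearMap_one] at h2
  exact hle hX

/-- Elements of the Lie algebra of `G ⊂ O(N)` are skew-adjoint. -/
lemma inner_eq_neg_of_mem_lieAlg {G : Subgroup (T N ≃ₗᵢ[ℝ] T N)} {X : Gl N} (hX : X ∈ lieAlg G)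
    (v w : T N) : inner ℝ (X v) w = -inner ℝ v (X w) := by
  let f : Gl N →ₗ[ℝ] ℝ :=
    { toFun := fun X => inner ℝ (X v) w + inner ℝ v (X w)
      map_add' := fun X Y => by simp [inner_add_left, inner_add_right]; ring
      map_smul' := fun c X => by simp [inner_smul_left, inner_smul_right]; ring }
  have hle : lieAlg G ≤ LinearMap.ker f := by
    refine Submodule.span_le.2 fun X hX => ?_
    have hd := hasDerivAt_exp_smul_const (𝕂 := ℝ) (LinearMap.toContinuousLinearMap X) 0
    have hv := hd.clm_apply (hasDerivAt_const (0 : ℝ) v)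
    have hw := hd.clm_apply (hasDerivAt_const (0 : ℝ) w)
    have h0 := hv.inner ℝ hw
    have h1 : (fun t : ℝ => inner ℝ
        (NormedSpace.exp (t • LinearMap.toContinuousLinearMap X) v)
        (NormedSpace.exp (t • LinearMap.toContinuousLinearMap X) w)) = fun _ => inner ℝ v w := by
      funext t
      obtain ⟨g, hg, hgt⟩ := hX t
      rw [← hgt]
      exact g.inner_map_map v w
    rw [h1] at h0
    have h2 := h0.unique (hasDerivAt_const 0 _)
    simp [exp_zero_smul_eq_one] at h2
    simp only [SetLike.mem_coe, LinearMap.mem_ker]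
    change inner ℝ (X v) w + inner ℝ v (X w) = 0
    linarith
  have := hle hX
  change inner ℝ (X v) w + inner ℝ v (X w) = 0 at this
  linarith

/-- An `o(N)`-valued `η` that is symmetric in its two arguments is zero (the first prolongation
of `o(N)` vanishes). -/
lemma disjoint_tensorT_lieAlg_symT (G : Subgroup (T N ≃ₗᵢ[ℝ] T N)) :
    Disjoint (tensorT (lieAlg G)) (symT N) := by
  rw [Submodule.disjoint_def]
  intro η h1 h2
  have sk : ∀ u v w, inner ℝ (η u v) w = -inner ℝ (η u w) v := fun u v w => by
    rw [inner_eq_neg_of_mem_lieAlg (h1 u), real_inner_comm]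
  have sy : ∀ u v, η u v = η v u := fun u v => h2 u v
  ext1 u
  ext1 v
  refine ext_inner_right ℝ fun w => ?_
  have e1 := sk u v w
  have e2 := sk w u v
  have e3 := sk v w u
  rw [sy u w] at e1
  rw [sy w v] at e2
  rw [sy v u] at e3
  simp only [LinearMap.zero_apply, inner_zero_left]
  linarith

end Action

/-! ### Complex coordinates and `su(n)` -/

section Coordinates

variable {n : ℕ}

lemma coord_apply {N i : ℕ} (h : i < N) (v : T N) : coord N i v = v ⟨i, h⟩ := by
  simp [coord, h]

lemma zMap_apply (v : T (2 * n + 1)) (j : Fin n) :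
    zMap n v j = ⟨coord (2 * n + 1) (2 * j) v, coord (2 * n + 1) (2 * j + 1) v⟩ := by
  apply Complex.ext <;> simp [zMap, zCoord]

/-- The last coordinate `α = θ^{2n+1}` as a functional. -/
abbrev alphaL (n : ℕ) : T (2 * n + 1) →L[ℝ] ℝ := coord (2 * n + 1) (2 * n)

lemma ext_zMap {v w : T (2 * n + 1)} (h : zMap n v = zMap n w) (h' : alphaL n v = alphaL n w) :
    v = w := by
  have hc : ∀ i : ℕ, i < 2 * n + 1 → coord (2 * n + 1) i v = coord (2 * n + 1) i w := by
    intro i hi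
    rcases Nat.lt_or_ge i (2 * n) with h2 | h2
    · have hz := congrFun h ⟨i / 2, by omega⟩
      rw [zMap_apply, zMap_apply, Complex.mk.injEq] at hz
      rcases Nat.even_or_odd' i with ⟨c, rfl | rfl⟩
      · have := hz.1
        simpa using this
      · have := hz.2
        have e : (2 * c + 1) / 2 = c := by omega
        simpa [e] using this
    · obtain rfl : i = 2 * n := by omega
      exact h'
  ext i
  have := hc i i.2
  rwa [coord_apply i.2, coord_apply i.2] at this

/-- The inclusion `ℂⁿ ⊂ T` inverting the complex coordinates. -/
def ofZ (n : ℕ) : (Fin n → ℂ) →ₗ[ℝ] T (2 * n + 1) where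
  toFun c := WithLp.toLp 2 fun i =>
    if h : (i : ℕ) < 2 * n then
      if (i : ℕ) % 2 = 0 then (c ⟨i / 2, by omega⟩).re else (c ⟨i / 2, by omega⟩).im
    else 0
  map_add' c d := by
    ext i
    simp only [PiLp.add_apply]
    split_ifs <;> simp
  map_smul' r c := by
    ext i
    simp only [PiLp.smul_apply]
    split_ifs <;> simp

@[simp] lemma zMap_ofZ (c : Fin n → ℂ) : zMap n (ofZ n c) = c := by
  funext j
  have h1 : 2 * (j : ℕ) < 2 * n := by omega
  have h2 : 2 * (j : ℕ) + 1 < 2 * n := by omega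
  have e : (2 * (j : ℕ) + 1) / 2 = j := by omega
  rw [zMap_apply, coord_apply (by omega), coord_apply (by omega)]
  apply Complex.ext <;> simp [ofZ, h1, h2, e]

@[simp] lemma alphaL_ofZ (c : Fin n → ℂ) : alphaL n (ofZ n c) = 0 := by
  rw [coord_apply (by omega)]
  simp [ofZ]

lemma sum_range_pairs (g : ℕ → ℝ) (m : ℕ) :
    ∑ i ∈ Finset.range (2 * m), g i = ∑ j ∈ Finset.range m, (g (2 * j) + g (2 * j + 1)) := by
  induction m with
  | zero => simp
  | succ m ih =>
    rw [show 2 * (m + 1) = 2 * m + 1 + 1 by ring, Finset.sum_range_succ, Finset.sum_range_succ,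
      ih, Finset.sum_range_succ]
    ring

/-- The Euclidean inner product in the coordinates `z`, `α`. -/
lemma inner_eq_zMap (v w : T (2 * n + 1)) :
    inner ℝ v w = (star (zMap n v) ⬝ᵥ zMap n w).re + alphaL n v * alphaL n w := by
  have h1 : inner ℝ v w = ∑ i ∈ Finset.range (2 * n + 1),
      coord (2 * n + 1) i v * coord (2 * n + 1) i w := by
    rw [Finset.sum_range, PiLp.inner_apply]
    refine Finset.sum_congr rfl fun i _ => ?_
    rw [coord_apply i.2, coord_apply i.2]
    simp [mul_comm]
  rw [h1, Finset.sum_range_succ, sum_range_pairs, Finset.sum_range]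
  simp [dotProduct, zMap_apply]

lemma F₀_apply (v : Fin 2 → T (2 * n + 1)) :
    F₀ n v = (star (zMap n (v 0)) ⬝ᵥ zMap n (v 1)).im := by
  change ∑ j : Fin n, _ = _
  simp only [dotProduct, Complex.im_sum]
  refine Finset.sum_congr rfl fun j _ => ?_
  simp [zMap_apply]
  ring

lemma Omega₀_apply (v : Fin n → T (2 * n + 1)) :
    Omega₀ n v = Matrix.det (Matrix.of fun k => zMap n (v k)) := rfl

lemma alpha₀_apply (v : Fin 1 → T (2 * n + 1)) : alpha₀ n v = alphaL n (v 0) := rfl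

/-- The endomorphism of `T` given by a complex matrix acting on the complex coordinates. -/
def op (S : Matrix (Fin n) (Fin n) ℂ) : Gl (2 * n + 1) :=
  ofZ n ∘ₗ (S.mulVecLin.restrictScalars ℝ) ∘ₗ zMap n

@[simp] lemma zMap_op (S : Matrix (Fin n) (Fin n) ℂ) (v : T (2 * n + 1)) :
    zMap n (op S v) = S.mulVec (zMap n v) := by
  simp [op]

@[simp] lemma alphaL_op (S : Matrix (Fin n) (Fin n) ℂ) (v : T (2 * n + 1)) :
    alphaL n (op S v) = 0 := by
  simp [op]

lemma act_alpha₀_apply (X : Gl (2 * n + 1)) (v : Fin 1 → T (2 * n + 1)) :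
    act (alpha₀ n) X v = alphaL n (X (v 0)) := by
  simp [act_apply, alpha₀_apply]

lemma act_F₀_apply (X : Gl (2 * n + 1)) (v : Fin 2 → T (2 * n + 1)) :
    act (F₀ n) X v = (star (zMap n (X (v 0))) ⬝ᵥ zMap n (v 1)).im +
      (star (zMap n (v 0)) ⬝ᵥ zMap n (X (v 1))).im := by
  simp [act_apply, F₀_apply]

lemma act_Omega₀_apply (X : Gl (2 * n + 1)) (v : Fin n → T (2 * n + 1)) :
    act (Omega₀ n) X v = ∑ i, Matrix.det
      ((Matrix.of fun k => zMap n (v k)).updateRow i (zMap n (X (v i)))) := by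
  rw [act_apply]
  refine Finset.sum_congr rfl fun i _ => ?_
  rw [Omega₀_apply]
  congr 1
  ext k j
  by_cases h : k = i
  · subst h; simp
  · simp [Function.update_of_ne h, Matrix.updateRow_ne h]

/-- The derivative of the determinant along `M ↦ M + ε M Sᵀ` is `tr S · det M`. -/
lemma sum_det_updateRow_mulVec (M S : Matrix (Fin n) (Fin n) ℂ) :
    ∑ i, (M.updateRow i (S.mulVec (M i))).det = S.trace * M.det := by
  have h : ∀ i, (M.updateRow i (S.mulVec (M i))).det =
      (M.transpose.adjugate * (S * M.transpose)) i i := by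
    intro i
    rw [← Matrix.cramer_transpose_apply, Matrix.cramer_eq_adjugate_mulVec]
    simp [Matrix.mul_apply, Matrix.mulVec, dotProduct]
  simp_rw [h]
  change Matrix.trace _ = _
  rw [Matrix.trace_mul_comm, Matrix.mul_assoc, Matrix.mul_adjugate]
  simp [mul_comm]

lemma act_Omega₀_op (S : Matrix (Fin n) (Fin n) ℂ) (v : Fin n → T (2 * n + 1)) :
    act (Omega₀ n) (op S) v = S.trace * Omega₀ n v := by
  rw [act_Omega₀_apply, Omega₀_apply, ← sum_det_updateRow_mulVec]
  simp only [zMap_op]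
  rfl

lemma star_mulVec_dotProduct_of_skew {S : Matrix (Fin n) (Fin n) ℂ} (hS : S.conjTranspose = -S)
    (a b : Fin n → ℂ) : star (S.mulVec a) ⬝ᵥ b = -(star a ⬝ᵥ S.mulVec b) := by
  rw [Matrix.star_mulVec, hS, ← Matrix.dotProduct_mulVec, Matrix.neg_mulVec, dotProduct_neg]

/-- Traceless skew-Hermitian matrices, acting on `ℂⁿ ⊂ T`, belong to the Lie algebra of `SU(n)`. -/
lemma op_mem_lieAlg {S : Matrix (Fin n) (Fin n) ℂ} (hS : S.conjTranspose = -S)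
    (htr : S.trace = 0) : op S ∈ lieAlg (SU n) := by
  refine Submodule.subset_span fun t => ?_
  set A : T (2 * n + 1) →L[ℝ] T (2 * n + 1) := t • LinearMap.toContinuousLinearMap (op S) with hA
  have hsk : A ∈ skewAdjoint (T (2 * n + 1) →L[ℝ] T (2 * n + 1)) := by
    rw [skewAdjoint.mem_iff, ContinuousLinearMap.star_eq_adjoint]
    symm
    rw [ContinuousLinearMap.eq_adjoint_iff]
    intro v w
    simp only [hA, neg_apply, smul_apply, inner_neg_left,
      inner_smul_left, inner_smul_right, LinearMap.coe_toContinuousLinearMap', inner_eq_zMap,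
      zMap_op, alphaL_op, star_mulVec_dotProduct_of_skew hS]
    simp
  let _ : NormedAlgebra ℚ (T (2 * n + 1) →L[ℝ] T (2 * n + 1)) :=
    NormedAlgebra.restrictScalars ℚ ℝ _
  have hu := NormedSpace.exp_mem_unitary_of_mem_skewAdjoint hsk
  let g : T (2 * n + 1) ≃ₗᵢ[ℝ] T (2 * n + 1) := Unitary.linearIsometryEquiv ⟨_, hu⟩
  have hg : toCLM g = NormedSpace.exp A := by
    ext1 v
    rfl
  refine ⟨g, ⟨?_, ?_, ?_⟩, hg⟩ <;> rw [hg, hA] <;>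
    refine compContinuousLinearMap_exp_of_act_eq_zero _ _ ?_ t
  · ext v
    rw [act_alpha₀_apply, alphaL_op]
    rfl
  · ext v
    rw [act_F₀_apply, zMap_op, zMap_op, star_mulVec_dotProduct_of_skew hS]
    simp
  · ext v
    rw [act_Omega₀_op, htr, zero_mul]
    rfl

end Coordinates

/-! ### Flags and Cartan's count -/

section AdaptedFlag

variable {N : ℕ} {E V : Type*} [AddCommGroup E] [Module ℝ E] [AddCommGroup V] [Module ℝ V]

/-- A complete flag together with a basis vector `e k` and a functional `φ k` for each step: `e k`
spans `W (k+1)` modulo `W k`, which is the kernel of `φ k` in `W (k+1)`. -/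
structure IsAdaptedFlag (W : Fin (N + 1) → Submodule ℝ E) (φ : Fin N → E →ₗ[ℝ] ℝ)
    (e : Fin N → E) : Prop where
  zero : W 0 = ⊥
  last : W (Fin.last N) = ⊤
  mem : ∀ k, e k ∈ W k.succ
  dual : ∀ k, φ k (e k) = 1
  mem_iff : ∀ k v, v ∈ W k.castSucc ↔ v ∈ W k.succ ∧ φ k v = 0

variable {W : Fin (N + 1) → Submodule ℝ E} {φ : Fin N → E →ₗ[ℝ] ℝ} {e : Fin N → E}

lemma IsAdaptedFlag.strictMono (hW : IsAdaptedFlag W φ e) : StrictMono W := by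
  refine Fin.strictMono_iff_lt_succ.2 fun k => ?_
  refine lt_of_le_of_ne (fun v hv => ((hW.mem_iff k v).1 hv).1) fun h => ?_
  have h1 := hW.mem k
  rw [← h, hW.mem_iff, hW.dual] at h1
  exact one_ne_zero h1.2

lemma IsAdaptedFlag.sub_smul_mem (hW : IsAdaptedFlag W φ e) (k : Fin N) {v : E}
    (hv : v ∈ W k.succ) : v - φ k v • e k ∈ W k.castSucc := by
  rw [hW.mem_iff]
  exact ⟨sub_mem hv (Submodule.smul_mem _ _ (hW.mem k)), by simp [hW.dual]⟩

lemma IsAdaptedFlag.vanish_succ_iff (hW : IsAdaptedFlag W φ e) (k : Fin N) (η : E →ₗ[ℝ] V) :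
    (∀ v ∈ W k.succ, η v = 0) ↔ (∀ v ∈ W k.castSucc, η v = 0) ∧ η (e k) = 0 := by
  refine ⟨fun h => ⟨fun v hv => h v ((hW.mem_iff k v).1 hv).1, h _ (hW.mem k)⟩, ?_⟩
  rintro ⟨h1, h2⟩ v hv
  have := h1 _ (hW.sub_smul_mem k hv)
  rwa [map_sub, map_smul, h2, smul_zero, sub_zero] at this

/-- If every step of the flag can be corrected by an element of `Z ≤ Z'`, then `Z' ≤ Z`. -/
lemma IsAdaptedFlag.le_of_correction (hW : IsAdaptedFlag W φ e) {Z Z' : Submodule ℝ (E →ₗ[ℝ] V)}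
    (hZ : Z ≤ Z')
    (h : ∀ k, ∀ η ∈ Z', (∀ v ∈ W k.castSucc, η v = 0) →
      ∃ ζ ∈ Z, (∀ v ∈ W k.castSucc, ζ v = 0) ∧ ζ (e k) = η (e k)) : Z' ≤ Z := by
  have key : ∀ k : Fin (N + 1), ∀ η ∈ Z', (∀ v ∈ W k, η v = 0) → η ∈ Z := by
    intro k
    induction k using Fin.reverseInduction with
    | last =>
      intro η _ h0
      have : η = 0 := LinearMap.ext fun v => h0 v (by rw [hW.last]; trivial)
      rw [this]
      exact Z.zero_mem
    | cast k ih =>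
      intro η hη h0
      obtain ⟨ζ, hζ, hζ0, hζe⟩ := h k η hη h0
      have := ih (η - ζ) (sub_mem hη (hZ hζ)) ((hW.vanish_succ_iff k _).2
        ⟨fun v hv => by simp [h0 v hv, hζ0 v hv], by simp [hζe]⟩)
      simpa using Z.add_mem this hζ
  intro η hη
  refine key 0 η hη fun v hv => ?_
  rw [hW.zero, Submodule.mem_bot] at hv
  simp [hv]

lemma eq_sum_of_telescope (f : Fin (N + 1) → ℕ) (h : Fin N → ℕ)
    (hs : ∀ k : Fin N, f k.castSucc = h k + f k.succ) (hl : f (Fin.last N) = 0) :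
    f 0 = ∑ k, h k := by
  induction N with
  | zero => simpa using hl
  | succ N ih =>
    have h0 := hs 0
    rw [Fin.castSucc_zero] at h0
    rw [h0, Fin.sum_univ_succ]
    congr 1
    exact ih (fun k => f k.succ) (fun k => h k.succ) (fun k => hs k.succ) hl

/-- Cartan's count: if the values at `e k` of the elements of `Z` vanishing on `W k` fill out
exactly the space `h k`, then `dim Z` is the sum of the dimensions of the `h k`. -/
lemma IsAdaptedFlag.finrank_eq_sum [FiniteDimensional ℝ E] [FiniteDimensional ℝ V]
    (hW : IsAdaptedFlag W φ e) (Z : Submodule ℝ (E →ₗ[ℝ] V)) (h : Fin N → Submodule ℝ V)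
    (h1 : ∀ k, ∀ η ∈ Z, (∀ v ∈ W k.castSucc, η v = 0) → η (e k) ∈ h k)
    (h2 : ∀ k, ∀ X ∈ h k, ∃ η ∈ Z, (∀ v ∈ W k.castSucc, η v = 0) ∧ η (e k) = X) :
    Module.finrank ℝ Z = ∑ k, Module.finrank ℝ (h k) := by
  let Zk : Fin (N + 1) → Submodule ℝ (E →ₗ[ℝ] V) := fun k =>
    { carrier := {η | η ∈ Z ∧ ∀ v ∈ W k, η v = 0}
      add_mem' := fun ha hb => ⟨Z.add_mem ha.1 hb.1, fun v hv => by simp [ha.2 v hv, hb.2 v hv]⟩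
      zero_mem' := ⟨Z.zero_mem, fun v _ => rfl⟩
      smul_mem' := fun c _ ha => ⟨Z.smul_mem c ha.1, fun v hv => by simp [ha.2 v hv]⟩ }
  have hZ0 : Zk 0 = Z := by
    ext η
    refine ⟨fun h => h.1, fun h => ⟨h, fun v hv => ?_⟩⟩
    rw [hW.zero, Submodule.mem_bot] at hv
    simp [hv]
  rw [← eq_sum_of_telescope (fun k => Module.finrank ℝ (Zk k)) _ ?_ ?_, hZ0]
  · intro k
    let f : Zk k.castSucc →ₗ[ℝ] V := (LinearMap.applyₗ (e k)) ∘ₗ (Zk k.castSucc).subtype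
    have hr : LinearMap.range f = h k := by
      ext X
      constructor
      · rintro ⟨η, rfl⟩
        exact h1 k η.1 η.2.1 η.2.2
      · intro hX
        obtain ⟨η, hη, h0, rfl⟩ := h2 k X hX
        exact ⟨⟨η, hη, h0⟩, rfl⟩
    have hk : (LinearMap.ker f).map (Zk k.castSucc).subtype = Zk k.succ := by
      ext η
      constructor
      · rintro ⟨⟨ζ, hζ⟩, h0, rfl⟩
        exact ⟨hζ.1, (hW.vanish_succ_iff k ζ).2 ⟨hζ.2, h0⟩⟩
      · intro hη
        have := (hW.vanish_succ_iff k η).1 hη.2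
        exact ⟨⟨η, hη.1, this.1⟩, this.2, rfl⟩
    rw [← LinearMap.finrank_range_add_finrank_ker f, hr, ← hk, Submodule.finrank_map_subtype_eq]
  · have : Zk (Fin.last N) = ⊥ := by
      refine (Submodule.eq_bot_iff _).2 fun η hη => LinearMap.ext fun v => hη.2 v ?_
      rw [hW.last]
      trivial
    change Module.finrank ℝ (Zk (Fin.last N)) = 0
    rw [this, finrank_bot]

end AdaptedFlag

section Flag

variable {n : ℕ}

/-- The zero-based index of the basis vector added at step `k` of the flag. -/
def flagIdx (n k : ℕ) : ℕ :=
  if k < n then 2 * k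
  else if k < 2 * n - 1 then 2 * (k - n) + 1
  else if k = 2 * n - 1 then 2 * n
  else 2 * n - 1

lemma mem_coordSpan {N : ℕ} (s : ℕ → Prop) (x : T N) :
    x ∈ coordSpan N s ↔ ∀ i : Fin N, ¬ s i → x i = 0 := by
  constructor
  · intro h i hi
    have hle : coordSpan N s ≤ LinearMap.ker (EuclideanSpace.proj i : T N →L[ℝ] ℝ).toLinearMap := by
      refine Submodule.span_le.2 ?_
      rintro _ ⟨j, hj, rfl⟩
      have : i ≠ j := fun h => hi (h ▸ hj)
      simp [this]
    exact hle h
  · intro h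
    have hx : x = ∑ i, x i • EuclideanSpace.single i (1 : ℝ) := by
      ext j
      simp [Finset.sum_apply, Pi.single_apply]
    rw [hx]
    refine Submodule.sum_mem _ fun i _ => ?_
    by_cases hi : s i
    · exact Submodule.smul_mem _ _ (Submodule.subset_span ⟨i, hi, rfl⟩)
    · rw [h i hi, zero_smul]
      exact Submodule.zero_mem _

lemma coordSpan_sup {N : ℕ} (s t : ℕ → Prop) :
    coordSpan N s ⊔ coordSpan N t = coordSpan N (fun i => s i ∨ t i) := by
  rw [coordSpan, coordSpan, coordSpan, ← Submodule.span_union]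
  congr 1
  ext x
  constructor
  · rintro (⟨i, h, rfl⟩ | ⟨i, h, rfl⟩)
    · exact ⟨i, Or.inl h, rfl⟩
    · exact ⟨i, Or.inr h, rfl⟩
  · rintro ⟨i, h | h, rfl⟩
    · exact Or.inl ⟨i, h, rfl⟩
    · exact Or.inr ⟨i, h, rfl⟩

lemma mem_coordSpan_congr {N : ℕ} {s t : ℕ → Prop} (h : ∀ i < N, s i ↔ t i) (x : T N) :
    x ∈ coordSpan N s ↔ x ∈ coordSpan N t := by
  rw [mem_coordSpan, mem_coordSpan]
  exact forall_congr' fun i => by rw [h i i.2]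

lemma mem_flag_iff_coordSpan (hn : 1 ≤ n) (k : Fin (2 * n + 1 + 1)) (x : T (2 * n + 1)) :
    x ∈ flag n k ↔ x ∈ coordSpan _ (fun i => ∃ j < (k : ℕ), flagIdx n j = i) := by
  have hk := k.2
  unfold flag
  split_ifs with h1 h2 h3
  · refine mem_coordSpan_congr (fun i hi => ?_) x
    refine exists_congr fun j => and_congr_right fun hj => ?_
    rw [flagIdx, if_pos (by omega)]
    exact eq_comm
  · rw [coordSpan_sup]
    refine mem_coordSpan_congr (fun i hi => ?_) x
    constructor
    · rintro (⟨j, hj, rfl⟩ | ⟨j, hj, rfl⟩)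
      · exact ⟨j, by omega, by simp [flagIdx, hj]⟩
      · refine ⟨n + j, by omega, ?_⟩
        rw [flagIdx, if_neg (by omega), if_pos (by omega)]
        omega
    · rintro ⟨j, hj, rfl⟩
      by_cases hjn : j < n
      · exact Or.inl ⟨j, hjn, by simp [flagIdx, hjn]⟩
      · refine Or.inr ⟨j - n, by omega, ?_⟩
        rw [flagIdx, if_neg (by omega), if_pos (by omega)]
  · rw [coordSpan_sup, coordSpan_sup]
    refine mem_coordSpan_congr (fun i hi => ?_) x
    constructor
    · rintro ((⟨j, hj, rfl⟩ | ⟨j, hj, rfl⟩) | rfl)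
      · exact ⟨j, by omega, by simp [flagIdx, hj]⟩
      · refine ⟨n + j, by omega, ?_⟩
        rw [flagIdx, if_neg (by omega), if_pos (by omega)]
        omega
      · refine ⟨2 * n - 1, by omega, ?_⟩
        rw [flagIdx, if_neg (by omega), if_neg (by omega), if_pos (by omega)]
    · rintro ⟨j, hj, rfl⟩
      by_cases hjn : j < n
      · exact Or.inl (Or.inl ⟨j, hjn, by simp [flagIdx, hjn]⟩)
      · by_cases hj2 : j < 2 * n - 1
        · refine Or.inl (Or.inr ⟨j - n, by omega, ?_⟩)
          rw [flagIdx, if_neg (by omega), if_pos (by omega)]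
        · refine Or.inr ?_
          rw [flagIdx, if_neg (by omega), if_neg (by omega), if_pos (by omega)]
  · refine ⟨fun _ => (mem_coordSpan _ x).2 fun i hi => absurd ?_ hi, fun _ => trivial⟩
    have hi2 := i.2
    rcases Nat.even_or_odd' (i : ℕ) with ⟨c, hc | hc⟩
    · by_cases hcn : c < n
      · exact ⟨c, by omega, by simp [flagIdx, hcn, hc]⟩
      · refine ⟨2 * n - 1, by omega, ?_⟩
        rw [flagIdx, if_neg (by omega), if_neg (by omega), if_pos (by omega)]
        omega
    · by_cases hcn : c + 1 < n
      · refine ⟨n + c, by omega, ?_⟩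
        rw [flagIdx, if_neg (by omega), if_pos (by omega)]
        omega
      · refine ⟨2 * n, by omega, ?_⟩
        rw [flagIdx, if_neg (by omega), if_neg (by omega), if_neg (by omega)]
        omega

/-- Membership in the flag, in the coordinates `z`, `α`. -/
lemma mem_flag (hn : 1 ≤ n) (k : Fin (2 * n + 1 + 1)) (x : T (2 * n + 1)) :
    x ∈ flag n k ↔ (∀ j : Fin n, (k : ℕ) ≤ j → (zMap n x j).re = 0) ∧
      (∀ j : Fin n, ((j : ℕ) + 1 < n → (k : ℕ) ≤ n + j) → (k : ℕ) ≤ 2 * n → (zMap n x j).im = 0) ∧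
      ((k : ℕ) < 2 * n → alphaL n x = 0) := by
  rw [mem_flag_iff_coordSpan hn, mem_coordSpan]
  simp only [zMap_apply]
  constructor
  · intro h
    refine ⟨fun j hj => ?_, fun j hj hk => ?_, fun hk => ?_⟩
    · rw [coord_apply (by omega)]
      refine h _ ?_
      rintro ⟨i, hi, he⟩
      simp only [flagIdx] at he
      split_ifs at he <;> omega
    · rw [coord_apply (by omega)]
      refine h _ ?_
      rintro ⟨i, hi, he⟩
      simp only [flagIdx] at he
      split_ifs at he <;> omega
    · rw [coord_apply (by omega)]
      refine h _ ?_
      rintro ⟨i, hi, he⟩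
      simp only [flagIdx] at he
      split_ifs at he <;> omega
  · rintro ⟨h1, h2, h3⟩ i hi
    have hi2 := i.2
    push Not at hi
    rw [← coord_apply hi2 x]
    rcases Nat.even_or_odd' (i : ℕ) with ⟨c, hc | hc⟩
    · rw [hc]
      by_cases hcn : c < n
      · refine h1 ⟨c, hcn⟩ ?_
        by_contra hlt
        exact hi c (by simpa using hlt) (by simp [flagIdx, hcn, hc])
      · obtain rfl : c = n := by omega
        refine h3 ?_
        by_contra hlt
        refine hi (2 * c - 1) (by omega) ?_
        rw [flagIdx, if_neg (by omega), if_neg (by omega), if_pos (by omega), hc]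
    · rw [hc]
      refine h2 ⟨c, by omega⟩ (fun hc1 => ?_) ?_
      · by_contra hlt
        refine hi (n + c) (by simpa using hlt) ?_
        simp only at hc1
        rw [flagIdx, if_neg (by omega), if_pos (by omega)]
        omega
      · by_contra hlt
        by_cases hcn : c + 1 < n
        · refine hi (n + c) (by omega) ?_
          rw [flagIdx, if_neg (by omega), if_pos (by omega)]
          omega
        · refine hi (2 * n) (by omega) ?_
          rw [flagIdx, if_neg (by omega), if_neg (by omega), if_neg (by omega)]
          omega

/-- The coordinate functional added at step `k` of the flag. -/
def flagFun (n : ℕ) (k : Fin (2 * n + 1)) : T (2 * n + 1) →ₗ[ℝ] ℝ :=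
  (coord (2 * n + 1) (flagIdx n k)).toLinearMap

lemma flagIdx_lt (hn : 1 ≤ n) {k : ℕ} (hk : k < 2 * n + 1) : flagIdx n k < 2 * n + 1 := by
  unfold flagIdx
  split_ifs <;> omega

lemma flagIdx_inj (hn : 1 ≤ n) {j k : ℕ} (hk : k < 2 * n + 1) (hj : j < 2 * n + 1)
    (h : flagIdx n j = flagIdx n k) : j = k := by
  unfold flagIdx at h
  split_ifs at h <;> omega

/-- The basis vector added at step `k` of the flag. -/
def flagVec (hn : 1 ≤ n) (k : Fin (2 * n + 1)) : T (2 * n + 1) :=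
  EuclideanSpace.single ⟨flagIdx n k, flagIdx_lt hn k.2⟩ 1

lemma isAdaptedFlag_flag (hn : 1 ≤ n) :
    IsAdaptedFlag (flag n) (flagFun n) (flagVec hn) where
  zero := by
    refine (Submodule.eq_bot_iff _).2 fun x hx => ?_
    rw [mem_flag_iff_coordSpan hn, mem_coordSpan] at hx
    ext i
    exact hx i (by simp)
  last := by
    simp [flag]
    intro h
    omega
  mem k := by
    rw [mem_flag_iff_coordSpan hn]
    exact Submodule.subset_span ⟨_, ⟨k, by simp, rfl⟩, rfl⟩
  dual k := by
    have := coord_apply (flagIdx_lt hn k.2) (flagVec hn k)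
    simp only [flagFun, ContinuousLinearMap.coe_coe, this]
    simp [flagVec]
  mem_iff k x := by
    have hc := coord_apply (flagIdx_lt hn k.2) x
    rw [mem_flag_iff_coordSpan hn, mem_flag_iff_coordSpan hn, mem_coordSpan, mem_coordSpan]
    simp only [flagFun, ContinuousLinearMap.coe_coe, hc, Fin.val_castSucc, Fin.val_succ]
    constructor
    · refine fun h => ⟨fun i hi => h i ?_, h _ ?_⟩
      · rintro ⟨j, hj, hji⟩
        exact hi ⟨j, by omega, hji⟩
      · rintro ⟨j, hj, hji⟩
        have := flagIdx_inj hn k.2 (by omega) hji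
        omega
    · rintro ⟨h1, h2⟩ i hi
      by_cases hik : flagIdx n k = i
      · obtain rfl : i = ⟨flagIdx n k, flagIdx_lt hn k.2⟩ := Fin.ext hik.symm
        exact h2
      · refine h1 i ?_
        rintro ⟨j, hj, hji⟩
        rcases Nat.lt_succ_iff_lt_or_eq.1 hj with h | rfl
        · exact hi ⟨j, h, hji⟩
        · exact hik hji

end Flag

/-! ### Solving the polar equations of the flag -/

section Prolongation

/-- The tensors `η` contributing nothing to the intrinsic torsion: `𝔤 ⊗ T` and `T ⊗ S²T`. -/
abbrev trivialTensors {N : ℕ} (G : Subgroup (T N ≃ₗᵢ[ℝ] T N)) : Submodule ℝ (GlT N) :=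
  tensorT (lieAlg G) ⊔ symT N

/-- A value `X` prescribed on one vector extends to an element of `(𝔤 ⊗ T) ⊕ (T ⊗ S²T)` vanishing
on `W ∩ ker φ` as soon as `X`, restricted to `W ∩ ker φ`, is the skew-symmetrization of some `γ` in
`𝔤 ⊗ T`: the symmetric tensor needed to correct `γ` is then prescribed consistently on `W`. -/
lemma exists_trivialTensor_of_skew {N : ℕ} {G : Subgroup (T N ≃ₗᵢ[ℝ] T N)} {γ : GlT N}
    (hγ : γ ∈ tensorT (lieAlg G)) (W : Submodule ℝ (T N)) (φ : T N →ₗ[ℝ] ℝ) (X : Gl N)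
    (h : ∀ v ∈ W, ∀ w ∈ W, X (φ v • w - φ w • v) = γ v w - γ w v) :
    ∃ η ∈ trivialTensors G, ∀ v ∈ W, η v = φ v • X := by
  obtain ⟨π₀, hπ₀⟩ := W.subtype.exists_leftInverse_of_injective W.ker_subtype
  let π : T N →ₗ[ℝ] T N := W.subtype ∘ₗ π₀
  have hπ : ∀ v, π v ∈ W := fun v => (π₀ v).2
  have hπW : ∀ v ∈ W, π v = v := fun v hv =>
    congrArg Subtype.val (LinearMap.congr_fun hπ₀ (⟨v, hv⟩ : W))
  let B : GlT N := φ.smulRight X - γ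
  have hB : ∀ v w, B v w = φ v • X w - γ v w := fun v w => by simp [B]
  have hBs : ∀ v ∈ W, ∀ w ∈ W, B v w = B w v := by
    intro v hv w hw
    have := h v hv w hw
    rw [map_sub, map_smul, map_smul] at this
    rw [hB, hB, sub_eq_sub_iff_sub_eq_sub, this]
  let C : GlT N := B ∘ₗ π
  let σ : GlT N := C + C.flip - C.compl₂ π
  have hσ : ∀ v w, σ v w = B (π v) w + B (π w) v - B (π v) (π w) := fun v w => rfl
  refine ⟨γ + σ, Submodule.add_mem_sup hγ fun v w => ?_, fun v hv => LinearMap.ext fun w => ?_⟩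
  · rw [hσ, hσ, hBs _ (hπ v) _ (hπ w)]
    abel
  · rw [LinearMap.add_apply, LinearMap.add_apply, hσ, hπW v hv, hBs _ (hπ w) v hv, hB v w]
    simp

variable {n : ℕ}

/-- `X` annihilates `α`, `F`, `Ω` restricted to `W`. -/
structure AnnihilatesOn (W : Submodule ℝ (T (2 * n + 1))) (X : Gl (2 * n + 1)) : Prop where
  alpha : ∀ v ∈ W, alphaL n (X v) = 0
  F : ∀ v ∈ W, ∀ w ∈ W,
    (star (zMap n (X v)) ⬝ᵥ zMap n w).im + (star (zMap n v) ⬝ᵥ zMap n (X w)).im = 0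
  Omega : ∀ v : Fin n → T (2 * n + 1), (∀ i, v i ∈ W) → act (Omega₀ n) X v = 0

/-- The unit vector with `z_l = 1`, i.e. the basis vector of zero-based index `2l`. -/
def reVec (l : Fin n) : T (2 * n + 1) := ofZ n (Pi.single l 1)

/-- The unit vector with `z_l = i`, i.e. the basis vector of zero-based index `2l + 1`. -/
def imVec (l : Fin n) : T (2 * n + 1) := ofZ n (Pi.single l Complex.I)

/-- The complex matrix of `X` on the vectors `θ₁, θ₃, …, θ_{2n-1}`. -/
def realMatrix (X : Gl (2 * n + 1)) : Matrix (Fin n) (Fin n) ℂ :=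
  Matrix.of fun j l => zMap n (X (reVec l)) j

lemma smul_sub_smul_mem_flag (hn : 1 ≤ n) (k : Fin (2 * n + 1)) {v w : T (2 * n + 1)}
    (hv : v ∈ flag n k.succ) (hw : w ∈ flag n k.succ) :
    flagFun n k v • w - flagFun n k w • v ∈ flag n k.castSucc := by
  rw [(isAdaptedFlag_flag hn).mem_iff]
  refine ⟨sub_mem (Submodule.smul_mem _ _ hw) (Submodule.smul_mem _ _ hv), ?_⟩
  simp [mul_comm]

/-- Reduction of the extension problem to complex matrices: `S` is the `𝔤`-valued coefficient of the
new vector, `Γ l` that of `reVec l`. -/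
lemma exists_trivialTensor_of_matrices (hn : 1 ≤ n) (k : Fin (2 * n + 1)) {X : Gl (2 * n + 1)}
    (hX : AnnihilatesOn (flag n k.castSucc) X) {S : Matrix (Fin n) (Fin n) ℂ}
    (hS : S.conjTranspose = -S) (htr : S.trace = 0) {Γ : Fin n → Matrix (Fin n) (Fin n) ℂ}
    (hΓ : ∀ l, (Γ l).conjTranspose = -Γ l) (hΓtr : ∀ l, (Γ l).trace = 0)
    (h : ∀ v ∈ flag n k.succ, ∀ w ∈ flag n k.succ, ∀ j,
      zMap n (X (flagFun n k v • w - flagFun n k w • v)) j =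
        S.mulVec (zMap n (flagFun n k v • w - flagFun n k w • v)) j +
        ∑ l, ∑ m, Γ l j m * ((zMap n v l).re * zMap n w m - (zMap n w l).re * zMap n v m)) :
    ∃ η ∈ trivialTensors (SU n), ∀ v ∈ flag n k.succ, η v = flagFun n k v • X := by
  let reL : Fin n → T (2 * n + 1) →ₗ[ℝ] ℝ := fun l =>
    Complex.reLm ∘ₗ LinearMap.proj l ∘ₗ zMap n
  let γ : GlT (2 * n + 1) := (flagFun n k).smulRight (op S) +
    ∑ l, (reL l).smulRight (op (Γ l))
  have hγ : ∀ v, γ v = flagFun n k v • op S + ∑ l, (zMap n v l).re • op (Γ l) := by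
    intro v
    simp only [γ, LinearMap.add_apply, LinearMap.sum_apply, LinearMap.smulRight_apply]
    rfl
  refine exists_trivialTensor_of_skew (γ := γ) (fun v => ?_) _ _ X fun v hv w hw => ?_
  · rw [hγ]
    exact Submodule.add_mem _ (Submodule.smul_mem _ _ (op_mem_lieAlg hS htr))
      (Submodule.sum_mem _ fun l _ => Submodule.smul_mem _ _ (op_mem_lieAlg (hΓ l) (hΓtr l)))
  · apply ext_zMap
    · funext j
      rw [h v hv w hw j]
      simp only [hγ, map_sub, map_add, map_smul, LinearMap.add_apply, LinearMap.smul_apply,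
        LinearMap.sum_apply, map_sum, zMap_op,
        Pi.sub_apply, Pi.add_apply, Pi.smul_apply, Finset.sum_apply, mul_sub,
        Finset.sum_sub_distrib, Matrix.mulVec, dotProduct, Complex.real_smul, Finset.mul_sum]
      simp only [mul_left_comm]
      ring
    · rw [hX.alpha _ (smul_sub_smul_mem_flag hn k hv hw)]
      simp [hγ]

lemma eq_sum_reVec {u : T (2 * n + 1)} (hα : alphaL n u = 0) (him : ∀ j, (zMap n u j).im = 0) :
    u = ∑ l, (zMap n u l).re • reVec l := by
  apply ext_zMap
  · funext j
    apply Complex.ext <;>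
      simp [reVec, him, Finset.sum_apply, Pi.single_apply]
  · simp [hα, reVec]

lemma zMap_apply_of_real (X : Gl (2 * n + 1)) {u : T (2 * n + 1)} (hα : alphaL n u = 0)
    (him : ∀ j, (zMap n u j).im = 0) : zMap n (X u) = (realMatrix X).mulVec (zMap n u) := by
  conv_lhs => rw [eq_sum_reVec hα him]
  funext j
  have hz : ∀ l, zMap n u l = ((zMap n u l).re : ℂ) := fun l => by
    apply Complex.ext <;> simp [him]
  simp only [map_sum, map_smul, Finset.sum_apply, Pi.smul_apply, Matrix.mulVec, dotProduct,
    realMatrix, Matrix.of_apply, Complex.real_smul]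
  refine Finset.sum_congr rfl fun l _ => ?_
  rw [← hz l, mul_comm]

lemma reVec_mem_flag (hn : 1 ≤ n) (k : Fin (2 * n + 1 + 1)) {l : Fin n} (h : (l : ℕ) < k) :
    reVec l ∈ flag n k := by
  rw [mem_flag hn]
  refine ⟨fun j hj => ?_, fun j _ _ => ?_, fun _ => ?_⟩
  · have : j ≠ l := by rintro rfl; omega
    simp [reVec, this]
  · by_cases hjl : j = l
    · subst hjl; simp [reVec]
    · simp [reVec, hjl]
  · simp [reVec]

lemma imVec_mem_flag (hn : 1 ≤ n) (k : Fin (2 * n + 1 + 1)) {l : Fin n} (h : n + (l : ℕ) < k)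
    (hl : (l : ℕ) + 1 < n) : imVec l ∈ flag n k := by
  rw [mem_flag hn]
  refine ⟨fun j _ => ?_, fun j hj _ => ?_, fun _ => ?_⟩
  · by_cases hjl : j = l
    · subst hjl; simp [imVec]
    · simp [imVec, hjl]
  · have : j ≠ l := by rintro rfl; have := hj hl; omega
    simp [imVec, this]
  · simp [imVec]

lemma AnnihilatesOn.im_realMatrix_symm {W : Submodule ℝ (T (2 * n + 1))} {X : Gl (2 * n + 1)}
    (hX : AnnihilatesOn W X) {j l : Fin n} (hj : reVec j ∈ W) (hl : reVec l ∈ W) :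
    (realMatrix X j l).im = (realMatrix X l j).im := by
  have h := hX.F _ hj _ hl
  simp only [reVec, zMap_ofZ, dotProduct_single, ← Pi.single_star, single_dotProduct] at h
  simp at h
  simp only [realMatrix, Matrix.of_apply, reVec]
  linarith

lemma AnnihilatesOn.re_realMatrix_skew {W : Submodule ℝ (T (2 * n + 1))} {X : Gl (2 * n + 1)}
    (hX : AnnihilatesOn W X) {j l : Fin n} (hj : imVec j ∈ W) (hl : reVec l ∈ W)
    (hlin : zMap n (X (imVec j)) l = realMatrix X l j * Complex.I) :
    (realMatrix X j l).re + (realMatrix X l j).re = 0 := by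
  have h := hX.F _ hj _ hl
  have h2 : (zMap n (X (imVec j)) l).im = (realMatrix X l j).re := by
    rw [hlin]; simp
  simp only [reVec, imVec, zMap_ofZ, dotProduct_single, ← Pi.single_star, single_dotProduct] at h
  simp at h
  simp only [realMatrix, Matrix.of_apply, reVec, imVec] at h2 ⊢
  linarith

lemma det_updateRow_one (m : Fin n) (b : Fin n → ℂ) :
    ((1 : Matrix (Fin n) (Fin n) ℂ).updateRow m b).det = b m := by
  have := Matrix.cramer_transpose_apply (1 : Matrix (Fin n) (Fin n) ℂ) b m
  rw [Matrix.transpose_one, Matrix.cramer_one] at this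
  exact this.symm

/-- Once `W` contains the Lagrangian subspace `⟨θ₁, θ₃, …⟩`, the equations of `Ω` say that `X` is
the restriction to `W` of a complex linear map of trace zero. -/
lemma AnnihilatesOn.complex_linear (hn : 1 ≤ n) {W : Submodule ℝ (T (2 * n + 1))}
    {X : Gl (2 * n + 1)} (hX : AnnihilatesOn W X) (hW : ∀ l, reVec l ∈ W) :
    (realMatrix X).trace = 0 ∧
      ∀ w ∈ W, zMap n (X w) = (realMatrix X).mulVec (zMap n w) := by
  set Y := realMatrix X with hY
  -- `X - Y` has no complex part on the vectors `reVec l`, so only one term of its action on `Ω` survives.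
  have hker : ∀ l, zMap n ((X - op Y) (reVec l)) = 0 := by
    intro l
    funext j
    simp [hY, realMatrix, reVec]
  have key : ∀ m, ∀ w ∈ W, zMap n ((X - op Y) w) m = -(Y.trace * zMap n w m) := by
    intro m w hw
    let v : Fin n → T (2 * n + 1) := Function.update reVec m w
    have hv : ∀ i, v i ∈ W := by
      intro i
      by_cases hi : i = m
      · subst hi; simpa [v] using hw
      · simpa [v, hi] using hW i
    have hM : (Matrix.of fun k => zMap n (v k)) =
        (1 : Matrix (Fin n) (Fin n) ℂ).updateRow m (zMap n w) := by
      ext k j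
      by_cases hk : k = m
      · subst hk; simp [v]
      · simp [v, hk, reVec, Matrix.one_apply, Pi.single_apply, eq_comm]
    have h1 : act (Omega₀ n) (X - op Y) v = -(Y.trace * zMap n w m) := by
      rw [map_sub, ContinuousAlternatingMap.sub_apply, hX.Omega v hv, act_Omega₀_op,
        Omega₀_apply, hM, det_updateRow_one, zero_sub]
    rw [← h1, act_Omega₀_apply, Finset.sum_eq_single m]
    · rw [hM, Matrix.updateRow_idem, det_updateRow_one]
      simp [v]
    · intro i _ hi
      refine Matrix.det_eq_zero_of_row_eq_zero i fun j => ?_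
      have : v i = reVec i := by simp [v, hi]
      rw [this, hker]
      simp
    · simp
  have htr : Y.trace = 0 := by
    have h := key ⟨0, hn⟩ _ (hW ⟨0, hn⟩)
    rw [hker] at h
    simpa [reVec] using h
  refine ⟨htr, fun w hw => funext fun m => ?_⟩
  have h := key m w hw
  rw [htr, zero_mul, neg_zero] at h
  simpa [sub_eq_zero] using h

end Prolongation

section Steps

variable {n : ℕ}

lemma flagFun_of_lt (k : Fin (2 * n + 1)) (κ : Fin n) (hk : (k : ℕ) = κ) (v : T (2 * n + 1)) :
    flagFun n k v = (zMap n v κ).re := by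
  have := κ.2
  rw [zMap_apply]
  simp [flagFun, flagIdx, hk]

lemma flagFun_of_eq_add (k : Fin (2 * n + 1)) (κ : Fin n) (hκ : (κ : ℕ) + 1 < n)
    (hk : (k : ℕ) = n + κ) (v : T (2 * n + 1)) : flagFun n k v = (zMap n v κ).im := by
  rw [zMap_apply]
  have : flagIdx n k = 2 * κ + 1 := by
    rw [flagIdx, if_neg (by omega), if_pos (by omega)]
    omega
  simp [flagFun, this]

/-- The steps `k < n`, where the flag consists of real vectors `θ₁, θ₃, …`. The matrix `Y` of `X`
splits into a skew-Hermitian part `S` and a real symmetric part `r`; the latter is the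
skew-symmetrization of the real rotations `Γ l` in the planes containing the new vector. -/
lemma exists_trivialTensor_real_step (hn : 1 ≤ n) (k : Fin (2 * n + 1)) (hk : (k : ℕ) < n)
    {X : Gl (2 * n + 1)} (hX : AnnihilatesOn (flag n k.castSucc) X) :
    ∃ η ∈ trivialTensors (SU n), ∀ v ∈ flag n k.succ, η v = flagFun n k v • X := by
  set κ : Fin n := ⟨k, hk⟩ with hκ
  set Y := realMatrix X with hY
  have hsym : ∀ j l : Fin n, j < κ → l < κ → (Y j l).im = (Y l j).im := fun j l hj hl =>
    hX.im_realMatrix_symm (reVec_mem_flag hn _ hj) (reVec_mem_flag hn _ hl)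
  let r : Fin n → Fin n → ℝ := fun j l => if j < κ ∧ l < κ then ((Y j l).re + (Y l j).re) / 2 else 0
  have hrs : ∀ j l, r j l = r l j := fun j l => by simp only [r, and_comm, add_comm]
  let d : Fin n → ℂ := fun j => if j < κ then (Y j j - star (Y j j)) / 2 else 0
  -- The entry at `(κ, κ)` is free and serves to make `S` traceless.
  let S : Matrix (Fin n) (Fin n) ℂ := Matrix.of fun j l =>
    if j < κ then if l < κ then (Y j l - star (Y l j)) / 2 else -star (Y l j)
    else if l < κ then Y j l
    else if j = κ ∧ l = κ then -∑ i, d i else 0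
  have hd : star (∑ i, d i) = -∑ i, d i := by
    rw [star_sum, ← Finset.sum_neg_distrib]
    refine Finset.sum_congr rfl fun i _ => ?_
    simp only [d]
    split_ifs
    · apply Complex.ext <;> simp
      ring
    · simp
  have hS : S.conjTranspose = -S := by
    ext j l
    simp only [Matrix.conjTranspose_apply, Matrix.neg_apply, S, Matrix.of_apply]
    by_cases hj : j < κ <;> by_cases hl : l < κ <;> simp only [hj, hl, if_true, if_false]
    · apply Complex.ext <;> simp <;> ring
    · simp
    · simp
    · by_cases h1 : j = κ <;> by_cases h2 : l = κ <;> simp [h1, h2]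
      have := congrArg Neg.neg hd
      simpa using this
  have htr : S.trace = 0 := by
    have h1 : ∀ j, S j j = d j + if j = κ then -∑ i, d i else 0 := by
      intro j
      by_cases hj : j < κ
      · simp [S, d, hj, hj.ne]
      · simp [S, d, hj]
    simp only [Matrix.trace, Matrix.diag, h1, Finset.sum_add_distrib, Finset.sum_ite_eq',
      Finset.mem_univ, if_true, add_neg_cancel]
  have hYS : ∀ j l, l < κ → Y j l = S j l + r j l := by
    intro j l hl
    by_cases hj : j < κ
    · have := hsym j l hj hl
      apply Complex.ext <;> simp [S, r, hj, hl]
      · ring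
      · rw [← this]; ring
    · simp [S, r, hj, hl]
  let Γ : Fin n → Matrix (Fin n) (Fin n) ℂ := fun l => Matrix.of fun j m =>
    (((if j = κ then r m l else 0) - if m = κ then r j l else 0 : ℝ) : ℂ)
  refine exists_trivialTensor_of_matrices hn k hX hS htr (Γ := Γ) (fun l => ?_) (fun l => ?_) ?_
  · ext j m
    simp only [Γ, Matrix.conjTranspose_apply, Matrix.neg_apply, Matrix.of_apply,
      Complex.star_def, Complex.conj_ofReal, ← Complex.ofReal_neg, neg_sub]
  · simp [Γ, Matrix.trace]
  · intro v hv w hw j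
    have hu := smul_sub_smul_mem_flag hn k hv hw
    set u := flagFun n k v • w - flagFun n k w • v with hu'
    rw [mem_flag hn] at hv hw hu
    simp only [Fin.val_succ, Fin.val_castSucc] at hv hw hu
    have him : ∀ x : T (2 * n + 1), (∀ j : Fin n, ((j : ℕ) + 1 < n → (k : ℕ) + 1 ≤ n + j) →
        (k : ℕ) + 1 ≤ 2 * n → (zMap n x j).im = 0) → ∀ j, zMap n x j = ((zMap n x j).re : ℂ) := by
      intro x hx j
      have := hx j (fun _ => by omega) (by omega)
      apply Complex.ext <;> simp [this]
    have hvr := him v hv.2.1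
    have hwr := him w hw.2.1
    have huim : ∀ j, (zMap n u j).im = 0 := fun j => hu.2.1 j (fun _ => by omega) (by omega)
    have hz : ∀ l, zMap n u l = (((zMap n v κ).re * (zMap n w l).re -
        (zMap n w κ).re * (zMap n v l).re : ℝ) : ℂ) := by
      intro l
      rw [hu', map_sub, map_smul, map_smul, flagFun_of_lt k κ rfl, flagFun_of_lt k κ rfl]
      simp only [Pi.sub_apply, Pi.smul_apply, Complex.real_smul]
      rw [hvr l, hwr l]
      simp
    rw [zMap_apply_of_real X (hu.2.2 (by omega)) huim]
    have h1 : (realMatrix X).mulVec (zMap n u) j =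
        S.mulVec (zMap n u) j + ∑ l, (r j l : ℂ) * zMap n u l := by
      simp only [Matrix.mulVec, dotProduct, ← Finset.sum_add_distrib]
      refine Finset.sum_congr rfl fun l _ => ?_
      by_cases hl : l < κ
      · rw [← hY, hYS j l hl, add_mul]
      · have : zMap n u l = 0 := Complex.ext (hu.1 l (not_lt.1 hl)) (huim l)
        simp [this]
    rw [h1]
    congr 1
    set x : Fin n → ℝ := fun l => (zMap n v l).re
    set y : Fin n → ℝ := fun l => (zMap n w l).re
    have h2 : ∀ l m, Γ l j m * (((zMap n v l).re : ℂ) * zMap n w m -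
        ((zMap n w l).re : ℂ) * zMap n v m) = (((if j = κ then r m l * (x l * y m - y l * x m) else 0)
          - if m = κ then r j l * (x l * y m - y l * x m) else 0 : ℝ) : ℂ) := by
      intro l m
      rw [hvr m, hwr m]
      simp only [Γ, Matrix.of_apply, ← Complex.ofReal_mul, ← Complex.ofReal_sub,
        sub_mul, ite_mul, zero_mul, x, y]
    simp only [h2, hz, ← Complex.ofReal_mul, ← Complex.ofReal_sum, Finset.sum_sub_distrib,
      Finset.sum_ite_eq', Finset.mem_univ, if_true]
    congr 1
    have h3 : ∑ l, ∑ m, (if j = κ then r m l * (x l * y m - y l * x m) else 0) = 0 := by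
      by_cases hj : j = κ
      · simp only [hj, if_true, mul_sub, Finset.sum_sub_distrib]
        rw [sub_eq_zero, Finset.sum_comm]
        refine Finset.sum_congr rfl fun l _ => Finset.sum_congr rfl fun m _ => ?_
        rw [hrs l m]
        ring
      · simp [hj]
    rw [h3, zero_sub, ← Finset.sum_neg_distrib]
    refine Finset.sum_congr rfl fun l _ => ?_
    simp only [x, y]
    ring

/-- The structure of the solutions of the polar equations at the steps `k ≥ n`: a traceless
skew-Hermitian matrix plus a traceless real symmetric one supported on those complex directions of
which the flag contains only the real part. -/
lemma AnnihilatesOn.exists_decomposition (hn : 1 ≤ n) (k : Fin (2 * n + 1)) (hk : n ≤ (k : ℕ))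
    {X : Gl (2 * n + 1)} (hX : AnnihilatesOn (flag n k.castSucc) X) :
    ∃ (S : Matrix (Fin n) (Fin n) ℂ) (r : Fin n → Fin n → ℝ),
      S.conjTranspose = -S ∧ S.trace = 0 ∧ (∀ j l, r j l = r l j) ∧ ∑ l, r l l = 0 ∧
      (∀ j l : Fin n, (j : ℕ) + 1 < n → n + (j : ℕ) < k → r j l = 0) ∧
      ∀ u ∈ flag n k.castSucc, ∀ j,
        zMap n (X u) j = S.mulVec (zMap n u) j + ∑ l, (r j l : ℂ) * zMap n u l := by
  have hre : ∀ l : Fin n, reVec l ∈ flag n k.castSucc := fun l =>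
    reVec_mem_flag hn _ (by simp; omega)
  obtain ⟨htr, hlin⟩ := hX.complex_linear hn hre
  set Y := realMatrix X with hY
  have hsym : ∀ j l, (Y j l).im = (Y l j).im := fun j l => hX.im_realMatrix_symm (hre j) (hre l)
  let r : Fin n → Fin n → ℝ := fun j l => ((Y j l).re + (Y l j).re) / 2
  let S : Matrix (Fin n) (Fin n) ℂ := Matrix.of fun j l => (Y j l - star (Y l j)) / 2
  have hYS : ∀ j l, Y j l = S j l + r j l := by
    intro j l
    have := hsym j l
    apply Complex.ext <;> simp [S, r]
    · ring
    · rw [← this]; ring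
  have htr2 : ∑ l, (Y l l).re = 0 := by
    have := congrArg Complex.re htr
    simpa [Matrix.trace] using this
  have hrtr : ∑ l, r l l = 0 := by
    rw [← htr2]
    refine Finset.sum_congr rfl fun l _ => ?_
    simp only [r]
    ring
  refine ⟨S, r, ?_, ?_, fun j l => ?_, hrtr, fun j l hj hjk => ?_, fun u hu j => ?_⟩
  · ext j l
    simp only [S, Matrix.conjTranspose_apply, Matrix.neg_apply, Matrix.of_apply]
    apply Complex.ext <;> simp <;> ring
  · have h1 : Y.trace = S.trace + ((∑ l, r l l : ℝ) : ℂ) := by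
      simp only [Matrix.trace, Matrix.diag, hYS, Finset.sum_add_distrib, Complex.ofReal_sum]
    rw [htr, hrtr] at h1
    simpa using h1.symm
  · simp only [r, add_comm]
  · have him : imVec j ∈ flag n k.castSucc := imVec_mem_flag hn _ (by simpa using hjk) hj
    have h := hX.re_realMatrix_skew him (hre l) (by
      rw [hlin _ him, imVec, zMap_ofZ, Matrix.mulVec_single]
      simp [hY, mul_comm])
    simp only [r, ← hY] at h ⊢
    linarith
  · rw [hlin u hu]
    simp only [Matrix.mulVec, dotProduct, ← Finset.sum_add_distrib, hYS, add_mul]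

/-- The steps `n ≤ k < 2n - 1`, adding `imVec κ` with `κ = k - n`. The real symmetric part
`r` is the contraction with the new vector of a totally symmetric traceless cubic tensor `t`, and
`i t` takes its values in `su(n)`. -/
lemma exists_trivialTensor_imaginary_step (hn : 1 ≤ n) (k : Fin (2 * n + 1)) (hk : n ≤ (k : ℕ))
    (hk2 : (k : ℕ) + 1 < 2 * n) {X : Gl (2 * n + 1)}
    (hX : AnnihilatesOn (flag n k.castSucc) X) :
    ∃ η ∈ trivialTensors (SU n), ∀ v ∈ flag n k.succ, η v = flagFun n k v • X := by
  obtain ⟨S, r, hS, htr, hrs, hrtr, hr0, hdec⟩ := hX.exists_decomposition hn k hk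
  set κ : Fin n := ⟨k - n, by omega⟩ with hκ
  have hκv : (κ : ℕ) = k - n := rfl
  have hr0' : ∀ j l : Fin n, j < κ → r j l = 0 := fun j l hj => by
    have : (j : ℕ) < κ := hj
    exact hr0 j l (by omega) (by omega)
  -- The diagonal entries `t l l l` compensate the trace of the entries involving `κ`.
  let t : Fin n → Fin n → Fin n → ℝ := fun j l m =>
    if j = κ then r l m else if l = κ then r j m else if m = κ then r j l
    else if j = l ∧ l = m then -r κ l else 0
  have ht1 : ∀ j l m, t j l m = t j m l := by
    intro j l m
    simp only [t]
    by_cases h1 : j = κ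
    · simp [h1, hrs]
    by_cases h2 : l = κ <;> by_cases h3 : m = κ
    · simp [h1, h2, h3]
    · simp [h1, h2, h3]
    · simp [h1, h2, h3]
    · simp only [h1, h2, h3, if_false]
      by_cases h4 : j = l ∧ l = m
      · obtain ⟨rfl, rfl⟩ := h4; rfl
      · rw [if_neg h4, if_neg (fun h => h4 ⟨h.1.trans h.2, h.2.symm⟩)]
  have ht2 : ∀ j l m, t j l m = t m l j := by
    intro j l m
    simp only [t]
    by_cases h1 : j = κ <;> by_cases h2 : l = κ <;> by_cases h3 : m = κ <;>
      simp only [h1, h2, h3, if_true, if_false]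
    · exact hrs _ _
    · exact hrs _ _
    · exact hrs _ _
    · exact hrs _ _
    · exact hrs _ _
    · by_cases h4 : j = l ∧ l = m
      · obtain ⟨rfl, rfl⟩ := h4; rfl
      · rw [if_neg h4, if_neg (fun h => h4 ⟨h.2.symm, h.1.symm⟩)]
  have htκ : ∀ j l, t j l κ = r j l := by
    intro j l
    simp only [t]
    by_cases h1 : j = κ
    · subst h1; simp [hrs]
    · by_cases h2 : l = κ
      · simp only [h1, h2, if_true, if_false]
      · simp [h1, h2]
  have htt : ∀ l, ∑ j, t j l j = 0 := by
    intro l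
    by_cases hl : l = κ
    · rw [← hrtr]
      refine Finset.sum_congr rfl fun j _ => ?_
      rw [ht1, hl, htκ]
    · have h1 : ∀ j, t j l j = (if j = κ then r κ l else 0) + if j = l then -r κ l else 0 := by
        intro j
        by_cases h1 : j = κ
        · subst h1; simp [t, hrs, Ne.symm hl]
        · by_cases h2 : j = l
          · subst h2; simp [t, h1]
          · simp [t, h1, hl, h2]
      simp only [h1, Finset.sum_add_distrib, Finset.sum_ite_eq', Finset.mem_univ, if_true,
        add_neg_cancel]
  have ht0 : ∀ j l m, m < κ → t j l m = 0 := by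
    intro j l m hm
    have h0 := fun l => hr0' m l hm
    simp only [t]
    split_ifs with h1 h2 h3 h4
    · rw [hrs, h0]
    · rw [hrs, h0]
    · exact absurd h3 hm.ne
    · rw [h4.2, hrs, h0, neg_zero]
    · rfl
  let Γ : Fin n → Matrix (Fin n) (Fin n) ℂ := fun l => Matrix.of fun j m => Complex.I * (t j l m : ℂ)
  refine exists_trivialTensor_of_matrices hn k hX hS htr (Γ := Γ) (fun l => ?_) (fun l => ?_) ?_
  · ext j m
    simp [Γ, ht2 m l j]
  · simp only [Γ, Matrix.trace, Matrix.diag, Matrix.of_apply, ← Finset.mul_sum,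
      ← Complex.ofReal_sum, htt, Complex.ofReal_zero, mul_zero]
  · intro v hv w hw j
    have hu := smul_sub_smul_mem_flag hn k hv hw
    rw [hdec _ hu]
    congr 1
    set u := flagFun n k v • w - flagFun n k w • v with hu'
    rw [mem_flag hn] at hv hw hu
    simp only [Fin.val_succ, Fin.val_castSucc] at hv hw hu
    have hfl := flagFun_of_eq_add k κ (by omega) (by omega)
    set x : Fin n → ℝ := fun l => (zMap n v l).re with hx
    set y : Fin n → ℝ := fun l => (zMap n w l).re with hy
    -- On the support of `t` the coordinates are real, except for the new one.
    have htz : ∀ a : T (2 * n + 1), (∀ j : Fin n, ((j : ℕ) + 1 < n → (k : ℕ) + 1 ≤ n + j) →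
        (k : ℕ) + 1 ≤ 2 * n → (zMap n a j).im = 0) → ∀ l m, (t j l m : ℂ) * zMap n a m =
          ((t j l m * (zMap n a m).re : ℝ) : ℂ) +
            Complex.I * ((if m = κ then r j l * flagFun n k a else 0 : ℝ) : ℂ) := by
      intro a ha l m
      rcases lt_trichotomy m κ with h | h | h
      · simp [ht0 j l m h, h.ne]
      · subst h
        rw [htκ, hfl]
        apply Complex.ext <;> simp
      · have h' : (κ : ℕ) < m := h
        have := ha m (fun _ => by omega) (by omega)
        apply Complex.ext <;> simp [this, h.ne']
    have hL : ∀ l, (r j l : ℂ) * zMap n u l =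
        ((r j l * (flagFun n k v * y l - flagFun n k w * x l) : ℝ) : ℂ) := by
      intro l
      have hure : (zMap n u l).re = flagFun n k v * y l - flagFun n k w * x l := by
        simp [hu', hx, hy]
      rw [← hure]
      by_cases h : l < κ
      · simp [hrs j l, hr0' l j h]
      · have h' : (κ : ℕ) ≤ l := not_lt.1 h
        have := hu.2.1 l (fun _ => by omega) (by omega)
        apply Complex.ext <;> simp [this]
    have hR : ∀ l m, Γ l j m * ((x l : ℂ) * zMap n w m - (y l : ℂ) * zMap n v m) =
        Complex.I * ((t j l m * (x l * y m - y l * x m) : ℝ) : ℂ) +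
          ((if m = κ then r j l * (flagFun n k v * y l - flagFun n k w * x l) else 0 : ℝ) : ℂ) := by
      intro l m
      have e1 := htz w hw.2.1 l m
      have e2 := htz v hv.2.1 l m
      have e3 : Γ l j m * ((x l : ℂ) * zMap n w m - (y l : ℂ) * zMap n v m) =
          Complex.I * ((x l : ℂ) * ((t j l m : ℂ) * zMap n w m) -
            (y l : ℂ) * ((t j l m : ℂ) * zMap n v m)) := by
        simp only [Γ, Matrix.of_apply]
        ring
      rw [e3, e1, e2]
      by_cases hm : m = κ
      · simp only [hm, if_true]
        apply Complex.ext <;> simp <;> ring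
      · simp only [hm, if_false]
        apply Complex.ext
        · simp
        · simp
          ring
    have h0 : ∑ l, ∑ m, t j l m * (x l * y m - y l * x m) = 0 := by
      simp only [mul_sub, Finset.sum_sub_distrib]
      rw [sub_eq_zero, Finset.sum_comm]
      refine Finset.sum_congr rfl fun l _ => Finset.sum_congr rfl fun m _ => ?_
      rw [ht1 j m l]
      ring
    change _ = ∑ l, ∑ m, Γ l j m * ((x l : ℂ) * zMap n w m - (y l : ℂ) * zMap n v m)
    simp only [hL, hR, Finset.sum_add_distrib, ← Finset.mul_sum, ← Complex.ofReal_sum, h0,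
      Finset.sum_ite_eq', Finset.mem_univ, if_true]
    simp

/-- The last two steps: all but one of the complex lines are contained in the flag, hence the
symmetric part vanishes and `X` is the restriction of an element of `su(n)`. -/
lemma exists_trivialTensor_last_steps (hn : 1 ≤ n) (k : Fin (2 * n + 1))
    (hk : 2 * n ≤ (k : ℕ) + 1) {X : Gl (2 * n + 1)}
    (hX : AnnihilatesOn (flag n k.castSucc) X) :
    ∃ η ∈ trivialTensors (SU n), ∀ v ∈ flag n k.succ, η v = flagFun n k v • X := by
  obtain ⟨S, r, hS, htr, hrs, hrtr, hr0, hdec⟩ := hX.exists_decomposition hn k (by omega)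
  have h1 : ∀ j l : Fin n, (j : ℕ) + 1 < n → r j l = 0 := fun j l hj => hr0 j l hj (by omega)
  have hr : ∀ j l, r j l = 0 := by
    intro j l
    by_cases hj : (j : ℕ) + 1 < n
    · exact h1 j l hj
    by_cases hl : (l : ℕ) + 1 < n
    · rw [hrs, h1 l j hl]
    obtain rfl : j = l := Fin.ext (by omega)
    rw [Finset.sum_eq_single j (fun i _ hi => h1 i i (by
      have : (i : ℕ) ≠ j := fun h => hi (Fin.ext h)
      omega)) (by simp)] at hrtr
    exact hrtr
  refine exists_trivialTensor_of_matrices hn k hX hS htr (Γ := 0) (by simp) (by simp) ?_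
  intro v hv w hw j
  rw [hdec _ (smul_sub_smul_mem_flag hn k hv hw)]
  simp [hr]

lemma exists_trivialTensor (hn : 1 ≤ n) (k : Fin (2 * n + 1)) {X : Gl (2 * n + 1)}
    (hX : AnnihilatesOn (flag n k.castSucc) X) :
    ∃ η ∈ trivialTensors (SU n), (∀ v ∈ flag n k.castSucc, η v = 0) ∧ η (flagVec hn k) = X := by
  have hW := isAdaptedFlag_flag hn
  have key : ∃ η ∈ trivialTensors (SU n), ∀ v ∈ flag n k.succ, η v = flagFun n k v • X := by
    by_cases h1 : (k : ℕ) < n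
    · exact exists_trivialTensor_real_step hn k h1 hX
    by_cases h2 : (k : ℕ) + 1 < 2 * n
    · exact exists_trivialTensor_imaginary_step hn k (by omega) h2 hX
    · exact exists_trivialTensor_last_steps hn k (by omega) hX
  obtain ⟨η, hη, h⟩ := key
  refine ⟨η, hη, fun v hv => ?_, ?_⟩
  · obtain ⟨h1, h2⟩ := (hW.mem_iff k v).1 hv
    rw [h v h1, h2, zero_smul]
  · rw [h _ (hW.mem k), hW.dual, one_smul]

end Steps

/-! ### Ordinarity and strong admissibility -/

section Ideal

variable {N : ℕ} {V : Type*} [NormedAddCommGroup V] [NormedSpace ℝ V]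

lemma mem_Z0_iff (A : ∀ p, Submodule ℝ (T N [⋀^Fin p]→L[ℝ] ℝ)) (η : GlT N) :
    η ∈ Z0 A ↔ ∀ p, ∀ β ∈ A p, gradAct β η = 0 := by
  refine forall_congr' fun p => forall_congr' fun β => imp_congr_right fun _ => ?_
  simp only [dTaut_graph, neg_eq_zero]
  exact ⟨fun h => ContinuousAlternatingMap.ext h, fun h v => by rw [h]; rfl⟩

lemma trivialTensors_le_Z0 (G : Subgroup (T N ≃ₗᵢ[ℝ] T N)) :
    trivialTensors G ≤ Z0 (invariantForms G) := by
  refine sup_le (fun η hη => ?_) fun η hη => ?_ <;> rw [mem_Z0_iff] <;> intro p β hβ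
  · exact gradAct_eq_zero_of_act β fun v => act_eq_zero_of_mem_lieAlg hβ (hη v)
  · exact gradAct_eq_zero_of_mem_symT β hη

/-- Where `η` vanishes on the remaining arguments, only one term of `gradAct` survives. -/
lemma gradAct_cons_of_vanish {p : ℕ} (β : T N [⋀^Fin p]→L[ℝ] V) {η : GlT N} {e : T N}
    {v : Fin p → T N} (hv : ∀ i, η (v i) = 0) :
    gradAct β η (Fin.cons e v : Fin (p + 1) → T N) = act β (η e) v := by
  rw [gradAct_apply, Fin.sum_univ_succ]
  simp [hv]

/-- The endomorphisms annihilating the restrictions to `W` of all the forms of `A`. -/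
def annihilator (A : ∀ p, Submodule ℝ (T N [⋀^Fin p]→L[ℝ] ℝ)) (W : Submodule ℝ (T N)) :
    Submodule ℝ (Gl N) where
  carrier := {X | ∀ p, ∀ β ∈ A p, ∀ v : Fin p → T N, (∀ i, v i ∈ W) → act β X v = 0}
  add_mem' hX hY p β hβ v hv := by simp [hX p β hβ v hv, hY p β hβ v hv]
  zero_mem' p β _ v _ := by simp
  smul_mem' c X hX p β hβ v hv := by simp [hX p β hβ v hv]

lemma polarSpace_prod_bot (A : ∀ p, Submodule ℝ (T N [⋀^Fin p]→L[ℝ] ℝ)) (W : Submodule ℝ (T N)) :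
    polarSpace A (W.prod ⊥) = (⊤ : Submodule ℝ (T N)).prod (annihilator A W) := by
  ext z
  constructor
  · refine fun hz => ⟨trivial, fun p β hβ v hv => ?_⟩
    have := hz p β hβ (fun i => (v i, 0)) fun i => ⟨hv i, rfl⟩
    rw [dTaut_cons β z _ fun _ => rfl, neg_eq_zero] at this
    exact this
  · rintro ⟨-, hz⟩ p β hβ e he
    rw [dTaut_cons β z e fun i => (he i).2, hz p β hβ _ fun i => (he i).1, neg_zero]

lemma polarRank_eq (A : ∀ p, Submodule ℝ (T N [⋀^Fin p]→L[ℝ] ℝ)) (W : Submodule ℝ (T N)) :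
    polarRank A W = Module.finrank ℝ (Gl N) - Module.finrank ℝ (annihilator A W) := by
  have e : ((⊤ : Submodule ℝ (T N)).prod (annihilator A W)) ≃ₗ[ℝ]
      (⊤ : Submodule ℝ (T N)) × annihilator A W :=
    { toFun := fun z => (⟨z.1.1, z.2.1⟩, ⟨z.1.2, z.2.2⟩)
      invFun := fun z => ⟨(z.1.1, z.2.1), z.1.2, z.2.2⟩
      map_add' := fun _ _ => rfl
      map_smul' := fun _ _ => rfl }
  rw [polarRank, polarSpace_prod_bot, e.finrank_eq, Module.finrank_prod, Module.finrank_prod,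
    finrank_top, Nat.add_sub_add_left]

end Ideal

section SpecialUnitary

variable {n : ℕ}

/-- The values of `-(dα, dF, dΩ)` on the graph of `η`. -/
def derivativeMap (n : ℕ) : GlT (2 * n + 1) →ₗ[ℝ]
    (T (2 * n + 1) [⋀^Fin 2]→L[ℝ] ℝ) × (T (2 * n + 1) [⋀^Fin 3]→L[ℝ] ℝ) ×
      (T (2 * n + 1) [⋀^Fin (n + 1)]→L[ℝ] ℂ) :=
  (gradAct (alpha₀ n)).prod ((gradAct (F₀ n)).prod (gradAct (Omega₀ n)))

lemma mem_ker_derivativeMap (η : GlT (2 * n + 1)) :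
    η ∈ LinearMap.ker (derivativeMap n) ↔
      gradAct (alpha₀ n) η = 0 ∧ gradAct (F₀ n) η = 0 ∧ gradAct (Omega₀ n) η = 0 := by
  change (gradAct (alpha₀ n) η, gradAct (F₀ n) η, gradAct (Omega₀ n) η) = 0 ↔ _
  rw [Prod.mk_eq_zero, Prod.mk_eq_zero]

lemma annihilatesOn_of_act {W : Submodule ℝ (T (2 * n + 1))} {X : Gl (2 * n + 1)}
    (hα : ∀ v, (∀ i, v i ∈ W) → act (alpha₀ n) X v = 0)
    (hF : ∀ v, (∀ i, v i ∈ W) → act (F₀ n) X v = 0)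
    (hΩ : ∀ v, (∀ i, v i ∈ W) → act (Omega₀ n) X v = 0) : AnnihilatesOn W X where
  alpha v hv := by
    rw [← hα (fun _ => v) fun _ => hv, act_alpha₀_apply]
  F v hv w hw := by
    have := hF ![v, w] (by simp [Fin.forall_fin_two, hv, hw])
    rwa [act_F₀_apply] at this
  Omega := hΩ

/-- The polar equations of the flag are solvable, hence the torsion is determined by
`dα`, `dF`, `dΩ` up to the image of `𝔤 ⊗ T`. -/
lemma ker_derivativeMap_le (hn : 1 ≤ n)
    (hle : trivialTensors (SU n) ≤ LinearMap.ker (derivativeMap n)) :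
    LinearMap.ker (derivativeMap n) ≤ trivialTensors (SU n) := by
  refine (isAdaptedFlag_flag hn).le_of_correction hle fun k η hη h0 => ?_
  refine exists_trivialTensor hn k ?_
  rw [mem_ker_derivativeMap] at hη
  obtain ⟨h1, h2, h3⟩ := hη
  refine annihilatesOn_of_act (fun v hv => ?_) (fun v hv => ?_) (fun v hv => ?_)
  · rw [← gradAct_cons_of_vanish _ fun i => h0 _ (hv i), h1]; rfl
  · rw [← gradAct_cons_of_vanish _ fun i => h0 _ (hv i), h2]; rfl
  · rw [← gradAct_cons_of_vanish _ fun i => h0 _ (hv i), h3]; rfl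

lemma alpha₀_mem : alpha₀ n ∈ invariantForms (SU n) 1 := fun _ hg => hg.1

lemma F₀_mem : F₀ n ∈ invariantForms (SU n) 2 := fun _ hg => hg.2.1

lemma compContinuousAlternatingMap_Omega₀_mem (f : ℂ →L[ℝ] ℝ) :
    f.compContinuousAlternatingMap (Omega₀ n) ∈ invariantForms (SU n) n := by
  intro g hg
  conv_rhs => rw [← hg.2.2]
  rfl

lemma Z0_le_ker_derivativeMap :
    Z0 (invariantForms (SU n)) ≤ LinearMap.ker (derivativeMap n) := by
  intro η hη
  rw [mem_Z0_iff] at hη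
  have hre := hη n _ (compContinuousAlternatingMap_Omega₀_mem Complex.reCLM)
  have him := hη n _ (compContinuousAlternatingMap_Omega₀_mem Complex.imCLM)
  rw [gradAct_compContinuousAlternatingMap] at hre him
  refine (mem_ker_derivativeMap η).2 ⟨hη 1 _ alpha₀_mem, hη 2 _ F₀_mem, ?_⟩
  ext v
  exact Complex.ext (congrArg (fun β => β v) hre) (congrArg (fun β => β v) him)

lemma ker_derivativeMap (hn : 1 ≤ n) :
    LinearMap.ker (derivativeMap n) = trivialTensors (SU n) :=
  have hle := (trivialTensors_le_Z0 (SU n)).trans Z0_le_ker_derivativeMap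
  le_antisymm (ker_derivativeMap_le hn hle) hle

lemma Z0_SU (hn : 1 ≤ n) : Z0 (invariantForms (SU n)) = trivialTensors (SU n) :=
  le_antisymm (Z0_le_ker_derivativeMap.trans (ker_derivativeMap hn).le) (trivialTensors_le_Z0 _)

lemma skew_eq_zero_of_mem_symT {N : ℕ} {η : GlT N} (h : η ∈ symT N) : skew N η = 0 := by
  ext v : 1
  exact sub_eq_zero.2 (h _ _)

lemma map_skew_trivialTensors {N : ℕ} (G : Subgroup (T N ≃ₗᵢ[ℝ] T N)) :
    (trivialTensors G).map (skew N) = (tensorT (lieAlg G)).map (skew N) := by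
  have h0 : (symT N).map (skew N) = ⊥ := by
    rw [eq_bot_iff, Submodule.map_le_iff_le_comap]
    exact fun η hη => skew_eq_zero_of_mem_symT hη
  rw [Submodule.map_sup, h0, sup_bot_eq]

lemma stronglyAdmissible_SU (hn : 1 ≤ n) : StronglyAdmissible (SU n) := by
  refine ⟨?_, disjoint_tensorT_lieAlg_symT _, Z0_SU hn⟩
  rw [Z0'', Z0_SU hn, map_skew_trivialTensors, Submodule.mkQ_map_self]

lemma annihilatesOn_of_mem_annihilator {W : Submodule ℝ (T (2 * n + 1))} {X : Gl (2 * n + 1)}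
    (hX : X ∈ annihilator (invariantForms (SU n)) W) : AnnihilatesOn W X := by
  refine annihilatesOn_of_act (fun v hv => hX 1 _ alpha₀_mem v hv)
    (fun v hv => hX 2 _ F₀_mem v hv) fun v hv => ?_
  have hre := hX n _ (compContinuousAlternatingMap_Omega₀_mem Complex.reCLM) v hv
  have him := hX n _ (compContinuousAlternatingMap_Omega₀_mem Complex.imCLM) v hv
  rw [act_compContinuousAlternatingMap] at hre him
  exact Complex.ext hre him

lemma isOrdinaryFlag_flag (hn : 1 ≤ n) : IsOrdinaryFlag (invariantForms (SU n)) (flag n) := by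
  have hW := isAdaptedFlag_flag hn
  refine ⟨hW.strictMono, hW.last, ?_⟩
  have hsum := hW.finrank_eq_sum (Z0 (invariantForms (SU n)))
    (fun k => annihilator (invariantForms (SU n)) (flag n k.castSucc))
    (fun k η hη h0 p β hβ v hv => by
      rw [← gradAct_cons_of_vanish β fun i => h0 _ (hv i), (mem_Z0_iff _ η).1 hη p β hβ]
      rfl)
    (fun k X hX => by
      rw [Z0_SU hn]
      exact exists_trivialTensor hn k (annihilatesOn_of_mem_annihilator hX))
  have hq := Submodule.finrank_quotient_add_finrank (Z0 (invariantForms (SU n)))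
  have hadd : ∑ k : Fin (2 * n + 1), (polarRank (invariantForms (SU n)) (flag n k.castSucc) +
      Module.finrank ℝ (annihilator (invariantForms (SU n)) (flag n k.castSucc))) =
      Module.finrank ℝ (GlT (2 * n + 1)) := by
    simp_rw [polarRank_eq, Nat.sub_add_cancel (Submodule.finrank_le _)]
    have : Module.Free ℝ (Gl (2 * n + 1)) := Module.Free.of_divisionRing ℝ _
    rw [Module.finrank_linearMap ℝ ℝ (T (2 * n + 1)) (Gl (2 * n + 1))]
    simp
  rw [Finset.sum_add_distrib, ← hsum, ← hq] at hadd
  exact Nat.add_right_cancel hadd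

end SpecialUnitary

/-! ### Intrinsic torsion on manifolds -/

section Intrinsic

variable {N : ℕ} {M : Type*} [TopologicalSpace M] [ChartedSpace (T N) M]

/-- A field of frames in the preferred chart at `x`. -/
def chartFrame (s : ∀ y : M, Frame N y) (x : M) (y : T N) : T N →L[ℝ] T N :=
  (mfderiv 𝓘(ℝ, T N) 𝓘(ℝ, T N) (extChartAt 𝓘(ℝ, T N) x) ((extChartAt 𝓘(ℝ, T N) x).symm y)) ∘L
    (s ((extChartAt 𝓘(ℝ, T N) x).symm y) : T N →L[ℝ] TangentSpace 𝓘(ℝ, T N) _)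

/-- The dual coframe of a field of frames in the preferred chart at `x`. -/
def chartCoframe (s : ∀ y : M, Frame N y) (x : M) (y : T N) : T N →L[ℝ] T N :=
  ((s ((extChartAt 𝓘(ℝ, T N) x).symm y)).symm : TangentSpace 𝓘(ℝ, T N) _ →L[ℝ] T N) ∘L
    (mfderiv 𝓘(ℝ, T N) 𝓘(ℝ, T N) (extChartAt 𝓘(ℝ, T N) x).symm y)

/-- The derivative at `x` of the coframe dual to `s` in the preferred chart at `x`, with all indices
referred to the frame `s x`. Its negative is the value at `x`, in the section `s`, of the connection
form of the flat connection of the chart. -/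
def frameDeriv (s : ∀ y : M, Frame N y) (x : M) : GlT N where
  toFun v := (LinearMap.toContinuousLinearMap.symm (fderiv ℝ (chartCoframe s x)
    (extChartAt 𝓘(ℝ, T N) x x) (chartFrame s x (extChartAt 𝓘(ℝ, T N) x x) v))) ∘ₗ
      (chartFrame s x (extChartAt 𝓘(ℝ, T N) x x)).toLinearMap
  map_add' v w := by
    ext1 a
    simp
  map_smul' c v := by
    ext1 a
    simp

lemma frameDeriv_apply (s : ∀ y : M, Frame N y) (x : M) (v w : T N) :
    frameDeriv s x v w = fderiv ℝ (chartCoframe s x) (extChartAt 𝓘(ℝ, T N) x x)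
      (chartFrame s x (extChartAt 𝓘(ℝ, T N) x x) v)
      (chartFrame s x (extChartAt 𝓘(ℝ, T N) x x) w) := rfl

variable [IsManifold 𝓘(ℝ, T N) ∞ M]

lemma mfderiv_symm_comp_mfderiv {x : M} {y : T N} (hy : y ∈ (extChartAt 𝓘(ℝ, T N) x).target) :
    (mfderiv 𝓘(ℝ, T N) 𝓘(ℝ, T N) (extChartAt 𝓘(ℝ, T N) x).symm y) ∘L
      (mfderiv 𝓘(ℝ, T N) 𝓘(ℝ, T N) (extChartAt 𝓘(ℝ, T N) x) ((extChartAt 𝓘(ℝ, T N) x).symm y))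
      = ContinuousLinearMap.id _ _ := by
  have := mfderivWithin_extChartAt_symm_comp_mfderiv_extChartAt (I := 𝓘(ℝ, T N)) hy
  rwa [ModelWithCorners.range_eq_univ, mfderivWithin_univ] at this

lemma mfderiv_comp_mfderiv_symm {x : M} {y : T N} (hy : y ∈ (extChartAt 𝓘(ℝ, T N) x).target) :
    (mfderiv 𝓘(ℝ, T N) 𝓘(ℝ, T N) (extChartAt 𝓘(ℝ, T N) x) ((extChartAt 𝓘(ℝ, T N) x).symm y)) ∘L
      (mfderiv 𝓘(ℝ, T N) 𝓘(ℝ, T N) (extChartAt 𝓘(ℝ, T N) x).symm y)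
      = ContinuousLinearMap.id _ _ := by
  have := mfderiv_extChartAt_comp_mfderivWithin_extChartAt_symm (I := 𝓘(ℝ, T N)) hy
  rwa [ModelWithCorners.range_eq_univ, mfderivWithin_univ] at this

lemma chartCoframe_comp_chartFrame (s : ∀ y : M, Frame N y) {x : M} {y : T N}
    (hy : y ∈ (extChartAt 𝓘(ℝ, T N) x).target) (v : T N) :
    chartCoframe s x y (chartFrame s x y v) = v := by
  have h := congrArg (fun f => f (s ((extChartAt 𝓘(ℝ, T N) x).symm y) v))
    (mfderiv_symm_comp_mfderiv hy)
  change (s _).symm _ = v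
  rw [ContinuousLinearEquiv.symm_apply_eq]
  exact h

lemma chartFrame_comp_chartCoframe (s : ∀ y : M, Frame N y) {x : M} {y : T N}
    (hy : y ∈ (extChartAt 𝓘(ℝ, T N) x).target) (v : T N) :
    chartFrame s x y (chartCoframe s x y v) = v := by
  have h := congrArg (fun f => f v) (mfderiv_comp_mfderiv_symm hy)
  change mfderiv 𝓘(ℝ, T N) 𝓘(ℝ, T N) (extChartAt 𝓘(ℝ, T N) x) _ (s _ ((s _).symm _)) = v
  rw [ContinuousLinearEquiv.apply_symm_apply]
  exact h

lemma differentiableAt_clm_of_apply {f : T N → T N →L[ℝ] T N} {y : T N}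
    (h : ∀ v, DifferentiableAt ℝ (fun y => f y v) y) : DifferentiableAt ℝ f y := by
  have hf : f = fun y => ∑ i, ContinuousLinearMap.smulRightL ℝ (T N) (T N)
      (EuclideanSpace.proj i : T N →L[ℝ] ℝ) (f y (EuclideanSpace.single i 1)) := by
    funext y
    ext1 v
    have hv : v = ∑ i, v i • EuclideanSpace.single i (1 : ℝ) := by
      ext j
      simp [Finset.sum_apply, Pi.single_apply]
    conv_lhs => rw [hv]
    simp [map_sum]
  rw [hf]
  exact DifferentiableAt.fun_sum fun i _ =>
    (ContinuousLinearMap.differentiableAt _).comp y (h _)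

lemma differentiableAt_chartFrame {s : ∀ y : M, Frame N y} {x : M} (hs : SmoothFrameAt s x) :
    DifferentiableAt ℝ (chartFrame s x) (extChartAt 𝓘(ℝ, T N) x x) := by
  refine differentiableAt_clm_of_apply fun v => ?_
  have h1 := hs.self_of_nhds v
  rw [Bundle.contMDiffAt_section] at h1
  have h2 : ContMDiffAt 𝓘(ℝ, T N) 𝓘(ℝ, T N) ∞ (fun m : M => (mfderiv 𝓘(ℝ, T N) 𝓘(ℝ, T N)
      (extChartAt 𝓘(ℝ, T N) x) m (s m v) : T N)) x := by
    refine h1.congr_of_eventuallyEq ?_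
    filter_upwards [(chartAt (T N) x).open_source.mem_nhds (mem_chart_source (T N) x)] with m hm
    have e1 := congrArg (fun f => f (s m v))
      (TangentBundle.continuousLinearMapAt_trivializationAt (I := 𝓘(ℝ, T N)) hm)
    have e2 : (trivializationAt (T N) (TangentSpace 𝓘(ℝ, T N)) x).continuousLinearMapAt ℝ m
        (s m v) = (trivializationAt (T N) (TangentSpace 𝓘(ℝ, T N)) x ⟨m, s m v⟩).2 := by
      rw [Bundle.Trivialization.continuousLinearMapAt_apply,
        Bundle.Trivialization.linearMapAt_apply, if_pos (by simpa using hm)]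
    exact e1.symm.trans e2
  have h3 : ContMDiffAt 𝓘(ℝ, T N) 𝓘(ℝ, T N) ∞ (extChartAt 𝓘(ℝ, T N) x).symm
      (extChartAt 𝓘(ℝ, T N) x x) :=
    (contMDiffOn_extChartAt_symm x).contMDiffAt (extChartAt_target_mem_nhds x)
  have h4 : (extChartAt 𝓘(ℝ, T N) x).symm (extChartAt 𝓘(ℝ, T N) x x) = x :=
    extChartAt_to_inv x
  have h5 := ContMDiffAt.comp (extChartAt 𝓘(ℝ, T N) x x) (by rw [h4]; exact h2) h3
  exact (contMDiffAt_iff_contDiffAt.1 h5).differentiableAt (by simp)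

lemma differentiableAt_chartCoframe {s : ∀ y : M, Frame N y} {x : M} (hs : SmoothFrameAt s x) :
    DifferentiableAt ℝ (chartCoframe s x) (extChartAt 𝓘(ℝ, T N) x x) := by
  have hinv : chartCoframe s x =ᶠ[𝓝 (extChartAt 𝓘(ℝ, T N) x x)]
      ContinuousLinearMap.inverse ∘ chartFrame s x := by
    filter_upwards [extChartAt_target_mem_nhds (I := 𝓘(ℝ, T N)) x] with y hy
    exact (ContinuousLinearMap.inverse_eq
      (ContinuousLinearMap.ext (chartFrame_comp_chartCoframe s hy))
      (ContinuousLinearMap.ext (chartCoframe_comp_chartFrame s hy))).symm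
  have hy := mem_extChartAt_target (I := 𝓘(ℝ, T N)) x
  have hi : (chartFrame s x (extChartAt 𝓘(ℝ, T N) x x)).IsInvertible :=
    ContinuousLinearMap.IsInvertible.of_inverse
      (ContinuousLinearMap.ext (chartFrame_comp_chartCoframe s hy))
      (ContinuousLinearMap.ext (chartCoframe_comp_chartFrame s hy))
  exact ((hi.contDiffAt_map_inverse (n := 1)).differentiableAt (by simp)).comp _
    (differentiableAt_chartFrame hs) |>.congr_of_eventuallyEq hinv

/-- The exterior derivative of a form with constant components in a field of frames. -/
lemma inFrame_extD {p : ℕ} {V : Type*} [NormedAddCommGroup V] [NormedSpace ℝ V]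
    (β : T N [⋀^Fin p]→L[ℝ] V) (b : DForm N M p V) {s : ∀ y : M, Frame N y} {x : M}
    (hs : SmoothFrameAt s x)
    (hb : ∀ᶠ y in 𝓝 x, b y = β.compContinuousLinearMap
      ((s y).symm : TangentSpace 𝓘(ℝ, T N) y →L[ℝ] T N)) :
    inFrame (extD b) (s x) = gradAct β (frameDeriv s x) := by
  set y₀ := extChartAt 𝓘(ℝ, T N) x x with hy₀
  have hsymm : Filter.Tendsto (extChartAt 𝓘(ℝ, T N) x).symm (𝓝 y₀) (𝓝 x) := by
    have := continuousAt_extChartAt_symm (I := 𝓘(ℝ, T N)) x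
    rwa [ContinuousAt, extChartAt_to_inv] at this
  have hrep : chartRep b x =ᶠ[𝓝 y₀] fun y => β.compContinuousLinearMap (chartCoframe s x y) := by
    filter_upwards [hsymm.eventually hb] with y hy
    rw [chartRep, hy]
    rfl
  have hσ := differentiableAt_chartCoframe hs
  have hd := (hasFDerivAt_const (𝕜 := ℝ) β y₀).continuousAlternatingMapCompContinuousLinearMap
    hσ.hasFDerivAt
  have htgt := mem_extChartAt_target (I := 𝓘(ℝ, T N)) x
  have hfr : ∀ v, (mfderiv 𝓘(ℝ, T N) 𝓘(ℝ, T N) (extChartAt 𝓘(ℝ, T N) x) x (s x v) : T N) =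
      chartFrame s x y₀ v := by
    intro v
    have h4 : (extChartAt 𝓘(ℝ, T N) x).symm (extChartAt 𝓘(ℝ, T N) x x) = x := extChartAt_to_inv x
    have hm : ∀ m, m = x → (mfderiv 𝓘(ℝ, T N) 𝓘(ℝ, T N) (extChartAt 𝓘(ℝ, T N) x) m (s m v) : T N) =
        mfderiv 𝓘(ℝ, T N) 𝓘(ℝ, T N) (extChartAt 𝓘(ℝ, T N) x) x (s x v) := by
      rintro _ rfl
      rfl
    exact (hm _ h4).symm
  ext v
  have e1 : inFrame (extD b) (s x) v =
      extDeriv (chartRep b x) y₀ fun i => chartFrame s x y₀ (v i) := by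
    simp only [← hfr]
    rfl
  rw [e1, hrep.extDeriv_eq, extDeriv, hd.fderiv, gradAct_apply,
    ContinuousAlternatingMap.alternatizeUncurryFin_apply]
  refine Finset.sum_congr rfl fun m _ => ?_
  congr 1
  rw [act_apply]
  simp only [ContinuousLinearMap.comp_zero, zero_add, ContinuousLinearMap.comp_apply,
    ContinuousAlternatingMap.fderivCompContinuousLinearMap_apply]
  refine Finset.sum_congr rfl fun i _ => congrArg β (funext fun j => ?_)
  by_cases hj : j = i
  · subst hj
    simp [frameDeriv_apply, Fin.removeNth, hy₀]
  · rw [Function.update_of_ne hj, Function.update_of_ne hj]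
    exact chartCoframe_comp_chartFrame s htgt _

lemma GStructure.inFrame_extD_form {G : Subgroup (T N ≃ₗᵢ[ℝ] T N)} (P : GStructure G M) {p : ℕ}
    {V : Type*} [NormedAddCommGroup V] [NormedSpace ℝ V] (β : T N [⋀^Fin p]→L[ℝ] V)
    (hβ : ∀ g ∈ G, β.compContinuousLinearMap (toCLM g) = β) {s : ∀ y : M, Frame N y} {x : M}
    (hs : SmoothFrameAt s x) (hP : ∀ᶠ y in 𝓝 x, s y ∈ P.frames y) :
    inFrame (extD (P.form β)) (s x) = gradAct β (frameDeriv s x) := by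
  refine inFrame_extD β _ hs ?_
  filter_upwards [hP] with y hy
  conv_rhs => rw [← P.form_comp_frame β hβ y (s y) hy]
  ext v
  simp [Function.comp_def]

/-- The tautological one-form `θ` has constant components, so `dθ` is the skew-symmetrization of the
derivative of the coframe. -/
lemma inFrame_extD_coframe {s : ∀ y : M, Frame N y} {x : M} (hs : SmoothFrameAt s x) :
    (inFrame (extD (coframe s)) (s x)).toAlternatingMap = skew N (frameDeriv s x) := by
  rw [inFrame_extD (ContinuousAlternatingMap.ofSubsingleton ℝ (T N) (T N) (0 : Fin 1)
    (ContinuousLinearMap.id ℝ (T N))) (coframe s) hs (Filter.Eventually.of_forall fun y => by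
      ext v
      rfl)]
  ext v : 1
  change gradAct _ (frameDeriv s x) v = frameDeriv s x (v 0) (v 1) - frameDeriv s x (v 1) (v 0)
  rw [gradAct_apply, Fin.sum_univ_two]
  simp [act_apply, Fin.removeNth, Fin.tail, sub_eq_add_neg]

lemma LocalConnection.mk_torsion {G : Subgroup (T N ≃ₗᵢ[ℝ] T N)} {P : GStructure G M} {x : M}
    (c : LocalConnection P x) :
    (Submodule.Quotient.mk c.torsion : IntrinsicTorsionSpace G) =
      Submodule.Quotient.mk (skew N (frameDeriv c.s x)) := by
  have h : c.torsion = skew N (frameDeriv c.s x) +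
      skew N ((c.a x).comp (c.s x).toLinearEquiv.toLinearMap) := by
    rw [← inFrame_extD_coframe c.smooth_s]
    rfl
  rw [h, Submodule.Quotient.eq, add_sub_cancel_left]
  exact Submodule.mem_map_of_mem fun v => c.a_mem.self_of_nhds _

lemma GStructure.exists_localConnection {G : Subgroup (T N ≃ₗᵢ[ℝ] T N)} (P : GStructure G M)
    {x : M} {u : Frame N x} (hu : u ∈ P.frames x) : ∃ c : LocalConnection P x, c.s x = u := by
  obtain ⟨s, hs, hP⟩ := P.exists_section x
  obtain ⟨g, hg, rfl⟩ := (P.mem_iff x (s x) hP.self_of_nhds u).1 hu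
  refine ⟨{ s := fun y => g.toContinuousLinearEquiv.trans (s y)
            smooth_s := hs.mono fun y hy v => hy (g v)
            s_mem := hP.mono fun y hy => (P.mem_iff y _ hy _).2 ⟨g, hg, rfl⟩
            a := fun _ => 0
            smooth_a := Filter.Eventually.of_forall fun y v w => contMDiffAt_const
            a_mem := Filter.Eventually.of_forall fun y w => Submodule.zero_mem _ }, rfl⟩

end Intrinsic

lemma exists_comp_eq_of_ker_le {E E' E'' : Type*} [AddCommGroup E] [Module ℝ E] [AddCommGroup E']
    [Module ℝ E'] [AddCommGroup E''] [Module ℝ E''] (D : E →ₗ[ℝ] E') (Q : E →ₗ[ℝ] E'')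
    (h : LinearMap.ker D ≤ LinearMap.ker Q) : ∃ L : E' →ₗ[ℝ] E'', L ∘ₗ D = Q := by
  obtain ⟨L, hL⟩ := LinearMap.exists_extend
    ((LinearMap.ker D).liftQ Q h ∘ₗ D.quotKerEquivRange.symm.toLinearMap)
  refine ⟨L, LinearMap.ext fun x => ?_⟩
  have := LinearMap.congr_fun hL ⟨D x, LinearMap.mem_range_self D x⟩
  rw [LinearMap.comp_apply, LinearMap.comp_apply, LinearEquiv.coe_coe,
    LinearMap.quotKerEquivRange_symm_apply_image D x] at this
  exact this

end OddSU

end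

theorem mainTheorem9 (n : ℕ) (hn : 1 ≤ n) :
    OddSU.IsOrdinaryFlag (OddSU.invariantForms (OddSU.SU n)) (OddSU.flag n) ∧
    OddSU.StronglyAdmissible (OddSU.SU n) ∧
    ∃ L : ((OddSU.T (2 * n + 1) [⋀^Fin 2]→L[ℝ] ℝ) × (OddSU.T (2 * n + 1) [⋀^Fin 3]→L[ℝ] ℝ) ×
          (OddSU.T (2 * n + 1) [⋀^Fin (n + 1)]→L[ℝ] ℂ)) →ₗ[ℝ]
        OddSU.IntrinsicTorsionSpace (OddSU.SU n),
      ∀ (M : Type*) [TopologicalSpace M] [ChartedSpace (OddSU.T (2 * n + 1)) M]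
        [IsManifold 𝓘(ℝ, OddSU.T (2 * n + 1)) ∞ M]
        (P : OddSU.GStructure (OddSU.SU n) M) (x : M),
        ∀ u ∈ P.frames x,
          P.IsIntrinsicTorsion x u
            (L (OddSU.inFrame (OddSU.extD (P.form (OddSU.alpha₀ n))) u,
                OddSU.inFrame (OddSU.extD (P.form (OddSU.F₀ n))) u,
                OddSU.inFrame (OddSU.extD (P.form (OddSU.Omega₀ n))) u)) := by
  refine ⟨OddSU.isOrdinaryFlag_flag hn, OddSU.stronglyAdmissible_SU hn, ?_⟩
  -- `L` exists because the class of `skew η` vanishes whenever `(dα, dF, dΩ)` does.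
  let Q : OddSU.GlT (2 * n + 1) →ₗ[ℝ] OddSU.IntrinsicTorsionSpace (OddSU.SU n) :=
    Submodule.mkQ _ ∘ₗ OddSU.skew (2 * n + 1)
  have hQ : LinearMap.ker (OddSU.derivativeMap n) ≤ LinearMap.ker Q := by
    intro η hη
    rw [OddSU.ker_derivativeMap hn] at hη
    rw [LinearMap.mem_ker, LinearMap.comp_apply, Submodule.mkQ_apply,
      Submodule.Quotient.mk_eq_zero, ← OddSU.map_skew_trivialTensors]
    exact Submodule.mem_map_of_mem hη
  obtain ⟨L, hL⟩ := OddSU.exists_comp_eq_of_ker_le _ Q hQ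
  refine ⟨L, fun M _ _ _ P x u hu => ⟨P.exists_localConnection hu, ?_⟩⟩
  rintro c rfl
  rw [c.mk_torsion, P.inFrame_extD_form _ (fun _ hg => hg.1) c.smooth_s c.s_mem,
    P.inFrame_extD_form _ (fun _ hg => hg.2.1) c.smooth_s c.s_mem,
    P.inFrame_extD_form _ (fun _ hg => hg.2.2) c.smooth_s c.s_mem]
  exact (LinearMap.congr_fun hL _).symm
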